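/- Let $V_1$ be the complex vector space of binary linear forms with the natural action of $SL_2=SL_2(\mathbb{C})$, $(g\cdot \ell)(x)=\ell(g^{-1}x)$, and let $SL_2$ act on $\mathbb{C}^2$ by matrix multiplication. For $n\ge 1$ let $\mathcal{I}_n=\mathbb{C}[nV_1]^{SL_2}$ be the algebra of joint invariants and $\mathcal{C}_n=\mathbb{C}[nV_1\oplus\mathbb{C}^2]^{SL_2}$ the algebra of joint covariants of $n$ binary linear forms, where $nV_1=V_1\oplus\cdots\oplus V_1$ ($n$ summands). Both are graded by the degree in the coefficients of the $n$ forms (the degree of a covariant in the coordinates of $\mathbb{C}^2$, its order, is not counted). For a graded algebra $R=\bigoplus_{j\ge 0}R_j$ that is one of these, let $\mathcal{P}(R,z)=\sum_{j\ge 0}\dim_{\mathbb{C}}(R_j)\,z^j$ be its Poincaré series, let $r$ be the transcendence degree over $\mathbb{C}$ of the quotient field of $R$, and let $$\deg(R)=\lim_{z\to 1^-}(1-z)^r\,\mathcal{P}(R,z)$$ be the degree of $R$. Then for every $n\ge 1$ the graded pieces of $\mathcal{I}_n$ and $\mathcal{C}_n$ are finite-dimensional, both transcendence degrees are finite, both Poincaré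 series converge for $0<z<1$, the limits defining $\deg(\mathcal{I}_n)$ and $\deg(\mathcal{C}_n)$ exist, and, as $n\to\infty$, $$\deg(\mathcal{I}_n)\sim\frac{1}{2\sqrt{\pi n^3}}\qquad\text{and}\qquad \deg(\mathcal{C}_n)\sim\frac{1}{\sqrt{\pi n}}.$$ -/

import Mathlib

namespace LinearForms

open MvPolynomial Matrix Filter Topology

/-- The natural action of `SL₂(ℂ)` on the space `V₁` of binary linear forms, in coefficients.
The form `ℓ = c 0 * X + c 1 * Y` is represented by its coefficient vector `c`, and `g` sends `ℓ` to
`ℓ ∘ g⁻¹`, whose coefficient vector is the row vector `c` times `g⁻¹`. -/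
def formAct (g : SpecialLinearGroup (Fin 2) ℂ) (c : Fin 2 → ℂ) : Fin 2 → ℂ :=
  c ᵥ* ((g⁻¹ : SpecialLinearGroup (Fin 2) ℂ) : Matrix (Fin 2) (Fin 2) ℂ)

/-- The algebra `𝓘ₙ = ℂ[n V₁]^{SL₂}` of joint invariants of `n` binary linear forms. The variable
with index `(i, k)` is the `k`-th coefficient of the `i`-th form. -/
def jointInvariants (n : ℕ) : Subalgebra ℂ (MvPolynomial (Fin n × Fin 2) ℂ) where
  carrier := {f | ∀ (g : SpecialLinearGroup (Fin 2) ℂ) (c : Fin n → Fin 2 → ℂ),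
    eval (fun p => formAct g (c p.1) p.2) f = eval (fun p => c p.1 p.2) f}
  mul_mem' := fun ha hb g c => by rw [map_mul, map_mul, ha g c, hb g c]
  add_mem' := fun ha hb g c => by rw [map_add, map_add, ha g c, hb g c]
  algebraMap_mem' := fun r g c => by simp [algebraMap_eq]

/-- The algebra `𝓒ₙ = ℂ[n V₁ ⊕ ℂ²]^{SL₂}` of joint covariants of `n` binary linear forms, where
`SL₂(ℂ)` acts on `ℂ²` by `x ↦ g x`. The variables `Sum.inl (i, k)` are the coefficients of the
forms, the variables `Sum.inr k` are the coordinates on `ℂ²`. -/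
def jointCovariants (n : ℕ) : Subalgebra ℂ (MvPolynomial ((Fin n × Fin 2) ⊕ Fin 2) ℂ) where
  carrier := {f | ∀ (g : SpecialLinearGroup (Fin 2) ℂ) (c : Fin n → Fin 2 → ℂ) (x : Fin 2 → ℂ),
    eval (Sum.elim (fun p => formAct g (c p.1) p.2)
      ((g : Matrix (Fin 2) (Fin 2) ℂ) *ᵥ x)) f =
    eval (Sum.elim (fun p => c p.1 p.2) x) f}
  mul_mem' := fun ha hb g c x => by rw [map_mul, map_mul, ha g c x, hb g c x]
  add_mem' := fun ha hb g c x => by rw [map_add, map_add, ha g c x, hb g c x]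
  algebraMap_mem' := fun r g c x => by simp [algebraMap_eq]

/-- `(𝓘ₙ)_j`: the joint invariants that are homogeneous of degree `j`. -/
noncomputable def invariantsGrading (n : ℕ) (j : ℕ) : Submodule ℂ (jointInvariants n) :=
  (homogeneousSubmodule (Fin n × Fin 2) ℂ j).comap (jointInvariants n).val.toLinearMap

/-- `(𝓒ₙ)_j`: the joint covariants of degree `j`. As usual for covariants, the degree is the one in
the coefficients of the forms; the degree in the coordinates of `ℂ²` (called the order of the
covariant) is not counted. -/
noncomputable def covariantsGrading (n : ℕ) (j : ℕ) : Submodule ℂ (jointCovariants n) :=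
  (weightedHomogeneousSubmodule ℂ
    (Sum.elim (fun _ => 1) (fun _ => 0) : (Fin n × Fin 2) ⊕ Fin 2 → ℕ) j).comap
      (jointCovariants n).val.toLinearMap

/-- The Poincaré series `∑ (dim R_j) z^j` of a graded complex algebra. -/
noncomputable def poincareSeries {R : Type*} [CommRing R] [Algebra ℂ R]
    (𝒜 : ℕ → Submodule ℂ R) : PowerSeries ℝ :=
  PowerSeries.mk fun j => (Module.finrank ℂ (𝒜 j) : ℝ)

/-- `d` is the degree of the graded complex domain `R = ⨁ 𝒜 j`: the graded pieces are
finite-dimensional, the quotient field of `R` has finite transcendence degree `r` over `ℂ`, the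
Poincaré series converges on `(0, 1)`, and `(1 - z) ^ r * P(R, z) → d` as `z → 1`. -/
def HasDegree {R : Type*} [CommRing R] [IsDomain R] [Algebra ℂ R]
    (𝒜 : ℕ → Submodule ℂ R) (d : ℝ) : Prop :=
  (∀ j, Module.Finite ℂ (𝒜 j)) ∧
  ∃ r : ℕ, Algebra.trdeg ℂ (FractionRing R) = r ∧
    (∀ z ∈ Set.Ioo (0 : ℝ) 1, Summable fun j => (poincareSeries 𝒜).coeff j * z ^ j) ∧
    Tendsto (fun z : ℝ => (1 - z) ^ r * ∑' j, (poincareSeries 𝒜).coeff j * z ^ j)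
      (𝓝[<] 1) (𝓝 d)

end LinearForms

namespace LinearForms

open MvPolynomial Matrix Filter Topology Asymptotics

/-! Both algebras become invariants of families of linear forms: `g⁻¹` is the adjugate of `g`, so a
vector is equivariantly a linear form, and covariants of `n` forms are invariants of `n + 1` forms,
graded by the degree in the first `n` only (`covariantEquiv_mem_iff`).

Dimensions come from `sl₂`. The polarization derivations and their commutator form an `sl₂`-triple
preserving the degree in each form, and invariants are the weight-zero vectors killed by the raising
operator. That operator maps weight 0 onto weight 2, so the dimension is the number of monomials of
weight 0 minus the number of weight 2 (`finrank_vectorInvariants`). With `N = n - 2`, the invariants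
of degree `2m` have dimension `C(m+N,N) C(m+N+1,N) / (N+1)` for `m > 0`, a Narayana number; there
are none in odd degree. For covariants almost everything cancels in the difference, and with `N = n
- 1` the degrees `2m` and `2m+1` give `C(m+N,N)²` and `C(m+N,N) C(m+1+N,N)`.

The transcendence degree is `2N + 1` in both cases: normalizing two independent forms to `X` and
`tY` embeds the invariants in a polynomial ring in `2N + 1` variables that is algebraic over them
(`slice_injective`, `slice_isAlgebraic`).

An Abelian theorem applied to even and odd degrees separately turns growth of dimensions into the
limit at 1. The degrees are `C(2N,N) / ((N+1) 2^(2N+1))` for invariants (`n ≥ 2`) and `C(2N,N) /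
4^N` for covariants; Stirling's formula gives the asymptotics. -/

/-! ### An Abelian theorem for power series at 1 -/

theorem abel_summable {a : ℕ → ℝ} {k : ℕ} {L : ℝ}
    (h : Tendsto (fun m => a m / ((m + k).choose k : ℝ)) atTop (𝓝 L)) {x : ℝ} (hx0 : 0 < x)
    (hx1 : x < 1) : Summable fun m => a m * x ^ m := by
  obtain ⟨M, hM⟩ := (Metric.isBounded_range_of_tendsto _ h).exists_norm_le
  have hb := (hasSum_choose_mul_geometric_of_norm_lt_one (𝕜 := ℝ) k (r := x)
    (by rwa [Real.norm_eq_abs, abs_of_pos hx0])).summable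
  refine Summable.of_norm_bounded (hb.mul_left M) fun m => ?_
  have hpos : (0 : ℝ) < ((m + k).choose k : ℝ) := by
    exact_mod_cast Nat.choose_pos (Nat.le_add_left k m)
  have h1 := hM _ (Set.mem_range_self m)
  rw [norm_div, Real.norm_of_nonneg hpos.le, div_le_iff₀ hpos] at h1
  rw [norm_mul, Real.norm_of_nonneg (pow_nonneg hx0.le m), ← mul_assoc]
  gcongr

/-- Comparison with `∑ C(m+k,k) x^m = (1-x)^(-(k+1))`: beyond some `N` the coefficients differ from
`L C(m+k,k)` by at most `ε/2` of it, and the first `N` terms contribute a bounded amount, killed by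
`(1-x)^(k+1)`. -/
theorem abel_tendsto {a : ℕ → ℝ} {k : ℕ} {L : ℝ}
    (h : Tendsto (fun m => a m / ((m + k).choose k : ℝ)) atTop (𝓝 L)) :
    Tendsto (fun x : ℝ => (1 - x) ^ (k + 1) * ∑' m, a m * x ^ m) (𝓝[<] 1) (𝓝 L) := by
  rw [Metric.tendsto_nhds]
  intro ε hε
  obtain ⟨N, hN⟩ := Metric.tendsto_atTop.1 h (ε / 2) (half_pos hε)
  set b : ℕ → ℝ := fun m => ((m + k).choose k : ℝ) with hbdef
  have hbpos (m) : 0 < b m := by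
    simp only [hbdef]
    exact_mod_cast Nat.choose_pos (Nat.le_add_left k m)
  set K : ℝ := ∑ m ∈ Finset.range N, |a m - L * b m| with hK
  have hlim : Tendsto (fun x : ℝ => (1 - x) ^ (k + 1) * K + ε / 2) (𝓝[<] 1) (𝓝 (ε / 2)) := by
    have : Continuous fun x : ℝ => (1 - x) ^ (k + 1) * K + ε / 2 := by fun_prop
    have := (this.tendsto 1).mono_left (nhdsWithin_le_nhds (s := Set.Iio 1))
    simpa using this
  have h0 : ∀ᶠ x : ℝ in 𝓝[<] 1, x ∈ Set.Ioo (0 : ℝ) 1 := Ioo_mem_nhdsLT one_pos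
  filter_upwards [hlim.eventually_lt_const (half_lt_self hε), h0] with x hx ⟨hx0, hx1⟩
  refine lt_of_le_of_lt ?_ hx
  have hB := hasSum_choose_mul_geometric_of_norm_lt_one (𝕜 := ℝ) k (r := x)
    (by rwa [Real.norm_eq_abs, abs_of_pos hx0])
  have hA := (abel_summable h hx0 hx1).hasSum
  have hp : 0 < (1 - x) ^ (k + 1) := pow_pos (by linarith) _
  have hdiff := hA.sub (hB.mul_left L)
  have hfin : HasSum (fun m => if m ∈ Finset.range N then |a m - L * b m| else 0) K := by
    rw [hK, ← Finset.sum_congr rfl fun m hm => if_pos hm]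
    exact hasSum_sum_of_ne_finset_zero fun m hm => if_neg hm
  have hmaj := hfin.add (hB.mul_left (ε / 2))
  have key : ‖(∑' m, a m * x ^ m) - L * (1 / (1 - x) ^ (k + 1))‖ ≤
      K + ε / 2 * (1 / (1 - x) ^ (k + 1)) := by
    rw [← hdiff.tsum_eq, ← hmaj.tsum_eq]
    refine tsum_of_norm_bounded hmaj.summable.hasSum fun m => ?_
    have e1 : a m * x ^ m - L * (b m * x ^ m) = (a m - L * b m) * x ^ m := by ring
    change ‖a m * x ^ m - L * (b m * x ^ m)‖ ≤ _ + ε / 2 * (b m * x ^ m)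
    rw [e1, norm_mul, Real.norm_of_nonneg (pow_nonneg hx0.le m), Real.norm_eq_abs]
    have hxm : 0 ≤ x ^ m := pow_nonneg hx0.le m
    split_ifs with hm
    · have : |a m - L * b m| * x ^ m ≤ |a m - L * b m| :=
        mul_le_of_le_one_right (abs_nonneg _) (pow_le_one₀ hx0.le hx1.le)
      have : 0 ≤ ε / 2 * (b m * x ^ m) := by have := hbpos m; positivity
      linarith
    · rw [zero_add, ← mul_assoc]
      gcongr
      have h2 := hN m (by simpa using hm)
      rw [Real.dist_eq] at h2
      have e2 : a m - L * b m = (a m / b m - L) * b m := by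
        have := (hbpos m).ne'
        field_simp
      rw [e2, abs_mul, abs_of_pos (hbpos m)]
      exact mul_le_mul_of_nonneg_right h2.le (hbpos m).le
  rw [dist_eq_norm]
  have e3 : (1 - x) ^ (k + 1) * ∑' m, a m * x ^ m - L =
      (1 - x) ^ (k + 1) * ((∑' m, a m * x ^ m) - L * (1 / (1 - x) ^ (k + 1))) := by
    field_simp
  rw [e3, norm_mul, Real.norm_of_nonneg hp.le]
  calc _ ≤ (1 - x) ^ (k + 1) * (K + ε / 2 * (1 / (1 - x) ^ (k + 1))) := by gcongr
    _ = _ := by field_simp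

theorem even_odd_hasSum {a : ℕ → ℝ} {k : ℕ} {L₀ L₁ : ℝ}
    (h₀ : Tendsto (fun m => a (2 * m) / ((m + k).choose k : ℝ)) atTop (𝓝 L₀))
    (h₁ : Tendsto (fun m => a (2 * m + 1) / ((m + k).choose k : ℝ)) atTop (𝓝 L₁))
    {z : ℝ} (hz0 : 0 < z) (hz1 : z < 1) :
    HasSum (fun j => a j * z ^ j)
      (∑' m, a (2 * m) * (z ^ 2) ^ m + z * ∑' m, a (2 * m + 1) * (z ^ 2) ^ m) := by
  have hx0 : 0 < z ^ 2 := by positivity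
  have hx1 : z ^ 2 < 1 := pow_lt_one₀ hz0.le hz1 two_ne_zero
  refine HasSum.even_add_odd ?_ ?_
  · convert! (abel_summable h₀ hx0 hx1).hasSum using 2
    rw [pow_mul]
  · convert! ((abel_summable (a := fun m => a (2 * m + 1)) h₁ hx0 hx1).hasSum).mul_left z using 2
    rw [pow_succ, pow_mul]
    ring

/-- Each half is a power series in `z²`, and `1 - z² = (1 - z)(1 + z)`; the factor `(1 + z)^(k+1)`
produces the power of 2. -/
theorem even_odd_tendsto {a : ℕ → ℝ} {k : ℕ} {L₀ L₁ : ℝ}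
    (h₀ : Tendsto (fun m => a (2 * m) / ((m + k).choose k : ℝ)) atTop (𝓝 L₀))
    (h₁ : Tendsto (fun m => a (2 * m + 1) / ((m + k).choose k : ℝ)) atTop (𝓝 L₁)) :
    Tendsto (fun z : ℝ => (1 - z) ^ (k + 1) * ∑' j, a j * z ^ j) (𝓝[<] 1)
      (𝓝 ((L₀ + L₁) / 2 ^ (k + 1))) := by
  have hsq : Tendsto (fun z : ℝ => z ^ 2) (𝓝[<] 1) (𝓝[<] 1) := by
    refine tendsto_nhdsWithin_of_tendsto_nhds_of_eventually_within _ ?_ ?_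
    · have : Continuous fun z : ℝ => z ^ 2 := by fun_prop
      simpa using (this.tendsto 1).mono_left (nhdsWithin_le_nhds (s := Set.Iio 1))
    · filter_upwards [Ioo_mem_nhdsLT (zero_lt_one' ℝ)] with z hz
      exact pow_lt_one₀ hz.1.le hz.2 two_ne_zero
  have hid : Tendsto (fun z : ℝ => z) (𝓝[<] 1) (𝓝 1) := nhdsWithin_le_nhds
  have hfac : Tendsto (fun z : ℝ => 1 / (1 + z) ^ (k + 1)) (𝓝[<] 1) (𝓝 (1 / 2 ^ (k + 1))) := by
    have : Tendsto (fun z : ℝ => 1 + z) (𝓝[<] 1) (𝓝 2) := by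
      convert! hid.const_add 1 using 2
      norm_num
    exact tendsto_const_nhds.div (this.pow _) (by positivity)
  have l₀ := (abel_tendsto h₀).comp hsq
  have l₁ := (abel_tendsto (a := fun m => a (2 * m + 1)) h₁).comp hsq
  have main := hfac.mul (l₀.add (hid.mul l₁))
  have e : 1 / 2 ^ (k + 1) * (L₀ + 1 * L₁) = (L₀ + L₁) / 2 ^ (k + 1) := by ring
  rw [e] at main
  refine main.congr' ?_
  filter_upwards [Ioo_mem_nhdsLT (zero_lt_one' ℝ)] with z hz
  rw [(even_odd_hasSum h₀ h₁ hz.1 hz.2).tsum_eq]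
  have h1 : (1 + z) ^ (k + 1) ≠ 0 := pow_ne_zero _ (by linarith [hz.1])
  have h2 : (1 - z ^ 2) ^ (k + 1) = (1 - z) ^ (k + 1) * (1 + z) ^ (k + 1) := by
    rw [← mul_pow]; ring
  simp only [Function.comp_apply, h2]
  field_simp

/-! ### Asymptotics of binomial coefficients -/

theorem tendsto_choose_div_pow (c k : ℕ) :
    Tendsto (fun m : ℕ => ((m + c).choose k : ℝ) / (m : ℝ) ^ k) atTop
      (𝓝 (1 / (k.factorial : ℝ))) := by
  have h1 : Tendsto (fun n : ℕ => (n.choose k : ℝ) / (n : ℝ) ^ k) atTop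
      (𝓝 (1 / (k.factorial : ℝ))) := by
    have hne : ∀ᶠ n : ℕ in atTop, (n : ℝ) ^ k / (k.factorial : ℝ) ≠ 0 := by
      filter_upwards [eventually_gt_atTop 0] with n hn
      positivity
    have := ((isEquivalent_iff_tendsto_one hne).1 (isEquivalent_choose k)).mul_const
      (1 / (k.factorial : ℝ))
    rw [one_mul] at this
    refine this.congr' ?_
    filter_upwards [eventually_gt_atTop 0] with n hn
    have : (n : ℝ) ≠ 0 := by positivity
    simp only [Pi.div_apply]
    field_simp
  have h2 := (tendsto_add_atTop_iff_nat c).2 h1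
  have h3 : Tendsto (fun m : ℕ => (((m : ℝ) + c) / m) ^ k) atTop (𝓝 1) := by
    have := ((tendsto_natCast_div_add_atTop (c : ℝ)).inv₀ one_ne_zero).pow k
    simpa using this
  have := h2.mul h3
  rw [mul_one] at this
  refine this.congr' ?_
  filter_upwards [eventually_gt_atTop 0] with n hn
  have : (n : ℝ) ≠ 0 := by positivity
  have : (n : ℝ) + c ≠ 0 := by positivity
  push_cast
  rw [div_pow]
  field_simp

/-- Shifts do not affect leading terms, so the limit is `(1/N!)² / (1/(2N)!)`. -/
theorem tendsto_choose_mul_choose_div (N c d : ℕ) :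
    Tendsto (fun m : ℕ => ((m + c).choose N * (m + d).choose N : ℝ) / ((m + 2 * N).choose (2 * N)))
      atTop (𝓝 (N.centralBinom)) := by
  have h := ((tendsto_choose_div_pow c N).mul (tendsto_choose_div_pow d N)).div
    (tendsto_choose_div_pow (2 * N) (2 * N)) (by positivity)
  have e : 1 / (N.factorial : ℝ) * (1 / (N.factorial : ℝ)) / (1 / ((2 * N).factorial : ℝ)) =
      N.centralBinom := by
    rw [Nat.centralBinom_eq_two_mul_choose, Nat.cast_choose ℝ (by omega : N ≤ 2 * N)]
    rw [show 2 * N - N = N by omega]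
    field_simp
  rw [e] at h
  refine h.congr' ?_
  filter_upwards [eventually_gt_atTop 0] with n hn
  have : (n : ℝ) ≠ 0 := by positivity
  simp only [Pi.div_apply]
  rw [two_mul, pow_add]
  field_simp

theorem centralBinom_isEquivalent :
    (fun N : ℕ => (N.centralBinom : ℝ) / 4 ^ N) ~[atTop] fun N => 1 / √(Real.pi * N) := by
  have h := Stirling.factorial_isEquivalent_stirling
  have h2 : (fun N : ℕ => ((2 * N).factorial : ℝ)) ~[atTop] fun N : ℕ =>
      √(2 * ((2 * N : ℕ) : ℝ) * Real.pi) * (((2 * N : ℕ) : ℝ) / Real.exp 1) ^ (2 * N) :=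
    h.comp_tendsto (k := fun N : ℕ => 2 * N) (tendsto_id.const_mul_atTop' two_pos)
  have h3 := (h2.div (h.mul h)).div (IsEquivalent.refl (u := fun N : ℕ => (4 : ℝ) ^ N))
  refine (h3.congr_left (Eventually.of_forall fun N => ?_)).congr_right ?_
  · simp only [Pi.div_apply, Pi.mul_apply]
    rw [Nat.centralBinom_eq_two_mul_choose, Nat.cast_choose ℝ (by omega : N ≤ 2 * N),
      show 2 * N - N = N by omega]
  · filter_upwards [eventually_gt_atTop 0] with N hN
    simp only [Pi.div_apply, Pi.mul_apply]
    have hN' : (0 : ℝ) < N := by exact_mod_cast hN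
    have hpi := Real.pi_pos
    have s1 : √(2 * ((2 * N : ℕ) : ℝ) * Real.pi) = 2 * √(Real.pi * N) := by
      rw [show 2 * ((2 * N : ℕ) : ℝ) * Real.pi = 2 ^ 2 * (Real.pi * N) by push_cast; ring,
        Real.sqrt_mul (by positivity), Real.sqrt_sq (by norm_num)]
    have s2 : √(2 * (N : ℝ) * Real.pi) * √(2 * (N : ℝ) * Real.pi) = 2 * (√(Real.pi * N) * √(Real.pi * N)) := by
      rw [Real.mul_self_sqrt (by positivity), Real.mul_self_sqrt (by positivity)]; ring
    have s3 : (((2 * N : ℕ) : ℝ) / Real.exp 1) ^ (2 * N) =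
        4 ^ N * (((N : ℝ) / Real.exp 1) ^ N * ((N : ℝ) / Real.exp 1) ^ N) := by
      rw [← pow_add, ← two_mul, show (4 : ℝ) = 2 ^ 2 by norm_num, ← pow_mul, ← mul_pow]
      push_cast; ring
    rw [s1, s3, show ∀ x y : ℝ, x * y * (x * y) = (x * x) * (y * y) by intros; ring, s2]
    have : √(Real.pi * N) ≠ 0 := by positivity
    have : ((N : ℝ) / Real.exp 1) ^ N ≠ 0 := by positivity
    field_simp

theorem centralBinom_pred_isEquivalent :
    (fun n : ℕ => ((n - 1).centralBinom : ℝ) / 4 ^ (n - 1)) ~[atTop] fun n => 1 / √(Real.pi * n) := by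
  have h := centralBinom_isEquivalent.comp_tendsto (tendsto_sub_atTop_nat 1)
  refine IsEquivalent.trans h ?_
  have hne : ∀ᶠ n : ℕ in atTop, 1 / √(Real.pi * n) ≠ 0 := by
    filter_upwards [eventually_gt_atTop 0] with n hn
    have := Real.pi_pos
    positivity
  rw [isEquivalent_iff_tendsto_one hne]
  rw [← tendsto_add_atTop_iff_nat 1]
  have h1 : Tendsto (fun n : ℕ => √(((n : ℝ) / (n + 1))⁻¹)) atTop (𝓝 1) := by
    have := ((tendsto_natCast_div_add_atTop (1 : ℝ)).inv₀ one_ne_zero).sqrt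
    simpa using this
  refine h1.congr' ?_
  filter_upwards [eventually_gt_atTop 0] with n hn
  have hn' : (0 : ℝ) < n := by exact_mod_cast hn
  have := Real.pi_pos
  simp only [Pi.div_apply, Function.comp_apply, Nat.add_sub_cancel, one_div, inv_div_inv]
  rw [← Real.sqrt_div (by positivity)]
  congr 1
  push_cast
  field_simp

theorem centralBinom_catalan_isEquivalent :
    (fun n : ℕ => ((n - 2).centralBinom : ℝ) / (((n - 1 : ℕ) : ℝ) * 2 ^ (2 * (n - 2) + 1))) ~[atTop]
      fun n => 1 / (2 * √(Real.pi * n ^ 3)) := by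
  have h0 := centralBinom_pred_isEquivalent.comp_tendsto (tendsto_sub_atTop_nat 1)
  have h1 : (fun n : ℕ => 1 / (2 * ((n - 1 : ℕ) : ℝ))) ~[atTop]
      fun n : ℕ => 1 / (2 * ((n - 1 : ℕ) : ℝ)) := IsEquivalent.refl
  have hne : ∀ᶠ n : ℕ in atTop, 1 / (2 * √(Real.pi * n ^ 3)) ≠ 0 := by
    filter_upwards [eventually_gt_atTop 0] with n hn
    have := Real.pi_pos
    positivity
  refine IsEquivalent.trans ((h0.mul h1).congr_left (Eventually.of_forall fun n => ?_)) ?_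
  · simp only [Pi.mul_apply, Function.comp_apply, Nat.sub_sub]
    rw [pow_succ, pow_mul]
    norm_num
    field_simp
  · rw [isEquivalent_iff_tendsto_one hne, ← tendsto_add_atTop_iff_nat 1]
    have h2 : Tendsto (fun n : ℕ => √((((n : ℝ) / (n + 1))⁻¹) ^ 3)) atTop (𝓝 1) := by
      have := (((tendsto_natCast_div_add_atTop (1 : ℝ)).inv₀ one_ne_zero).pow 3).sqrt
      simpa using this
    refine h2.congr' ?_
    filter_upwards [eventually_gt_atTop 0] with n hn
    have hn' : (0 : ℝ) < n := by exact_mod_cast hn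
    have hpi := Real.pi_pos
    simp only [Pi.div_apply, Pi.mul_apply, Function.comp_apply, Nat.add_sub_cancel]
    have e1 : 1 / √(Real.pi * n) * (1 / (2 * (n : ℝ))) = 1 / (2 * √(Real.pi * n ^ 3)) := by
      rw [show Real.pi * (n : ℝ) ^ 3 = n ^ 2 * (Real.pi * n) by ring, Real.sqrt_mul (sq_nonneg _),
        Real.sqrt_sq hn'.le]
      field_simp
    rw [e1, show ∀ s t : ℝ, 1 / (2 * s) / (1 / (2 * t)) = t / s by intros; field_simp, ← Real.sqrt_div (by positivity)]
    congr 1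
    push_cast
    field_simp

/-! ### Locally nilpotent representations of `sl₂` -/

section Sl2

variable {V : Type*} [AddCommGroup V] [Module ℂ V] {E F H : V →ₗ[ℂ] V}

theorem weight_pow (hHE : ∀ v, H (E v) = E (H v) + (2 : ℂ) • E v) {v : V} {μ : ℂ}
    (hv : H v = μ • v) (k : ℕ) : H ((E ^ k) v) = (μ + 2 * k) • (E ^ k) v := by
  induction k with
  | zero => simp [hv]
  | succ k ih =>
    rw [pow_succ', Module.End.mul_apply, hHE, ih, map_smul, ← add_smul]
    push_cast
    ring_nf

theorem raising_pow_lowering (hEF : ∀ v, E (F v) = F (E v) + H v)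
    (hHE : ∀ v, H (E v) = E (H v) + (2 : ℂ) • E v) {v : V} {μ : ℂ} (hv : H v = μ • v) (k : ℕ) :
    (E ^ (k + 1)) (F v) = F ((E ^ (k + 1)) v) + ((k + 1) * (μ + k) : ℂ) • (E ^ k) v := by
  induction k with
  | zero => simp [hEF, hv]
  | succ k ih =>
    rw [pow_succ', Module.End.mul_apply, ih, map_add, map_smul, hEF, weight_pow hHE hv,
      ← Module.End.mul_apply E, ← pow_succ', ← Module.End.mul_apply E, ← pow_succ', add_assoc,
      ← add_smul]
    push_cast
    ring_nf

/-- Surjectivity of `E` onto positive weight spaces, without complete reducibility. The submodule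
`p` will bound the multidegree. -/
theorem exists_raising_eq (hEF : ∀ v, E (F v) = F (E v) + H v)
    (hHE : ∀ v, H (E v) = E (H v) + (2 : ℂ) • E v)
    (hHF : ∀ v, H (F v) = F (H v) - (2 : ℂ) • F v) {p : Submodule ℂ V} (hE : ∀ v ∈ p, E v ∈ p)
    (hF : ∀ v ∈ p, F v ∈ p) {μ : ℂ} (hμ : ∀ k : ℕ, μ + k ≠ 0) (k : ℕ) {v : V} (hvp : v ∈ p)
    (hv : H v = μ • v) (hk : (E ^ k) v = 0) : ∃ u ∈ p, H u = (μ - 2) • u ∧ E u = v := by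
  induction k generalizing v with
  | zero => exact ⟨0, p.zero_mem, by simp, by simpa using hk.symm⟩
  | succ k ih =>
    -- With this constant, `raising_pow_lowering` and `E^(k+1) v = 0` give `E^k (E F v - c v) = 0`.
    -- By induction `E F v - c v = E u`, whence `v = E (c⁻¹ (F v - u))`.
    set c : ℂ := (k + 1) * (μ + k) with hc
    have hc0 : c ≠ 0 := mul_ne_zero (by exact_mod_cast k.succ_ne_zero) (hμ k)
    have hHFv : H (F v) = (μ - 2) • F v := by rw [hHF, hv, map_smul, sub_smul]
    obtain ⟨u, hup, hu, huv⟩ := ih (v := E (F v) - c • v)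
      (p.sub_mem (hE _ (hF _ hvp)) (p.smul_mem _ hvp))
      (by rw [map_sub, map_smul, hHE, hHFv, hv, map_smul]; module)
      (by rw [map_sub, map_smul, ← Module.End.mul_apply, ← pow_succ, raising_pow_lowering hEF hHE hv,
            hk, map_zero, zero_add, sub_self])
    refine ⟨c⁻¹ • (F v - u), p.smul_mem _ (p.sub_mem (hF _ hvp) hup), ?_, ?_⟩
    · rw [map_smul, map_sub, hHFv, hu]; module
    · rw [map_smul, map_sub, huv, sub_sub_cancel, inv_smul_smul₀ hc0]

/-- A highest weight vector of negative weight vanishes. Exchanging `E` with `F` and `H` with `-H`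
in `raising_pow_lowering`, the relations `E v = 0` and `F^(k+1) v = 0` force `F^k v = 0`, and the
exponent descends to 0. -/
theorem eq_zero_of_raising_eq_zero (hEF : ∀ v, E (F v) = F (E v) + H v)
    (hHF : ∀ v, H (F v) = F (H v) - (2 : ℂ) • F v) {μ : ℂ} (hμ : ∀ k : ℕ, μ + k ≠ 0) {v : V}
    (hv : H v = (-μ) • v) (hEv : E v = 0) (k : ℕ) (hk : (F ^ k) v = 0) : v = 0 := by
  induction k with
  | zero => simpa using hk
  | succ k ih =>
    have h := raising_pow_lowering (E := F) (F := E) (H := -H) (v := v) (μ := μ)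
      (fun v => by rw [hEF, LinearMap.neg_apply, add_neg_cancel_right])
      (fun v => by simp only [LinearMap.neg_apply, map_neg, hHF]; abel)
      (by rw [LinearMap.neg_apply, hv, neg_smul, neg_neg]) k
    rw [hEv, hk, map_zero, map_zero, zero_add, eq_comm, smul_eq_zero] at h
    exact ih (h.resolve_left (mul_ne_zero (by exact_mod_cast k.succ_ne_zero) (hμ k)))

end Sl2

/-- The `SL₂`-invariant polynomials in the coefficients of a family of linear forms. -/
def vectorInvariants (σ : Type*) : Subalgebra ℂ (MvPolynomial (σ × Fin 2) ℂ) where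
  carrier := {f | ∀ (g : SpecialLinearGroup (Fin 2) ℂ) (c : σ → Fin 2 → ℂ),
    eval (fun p => formAct g (c p.1) p.2) f = eval (fun p => c p.1 p.2) f}
  mul_mem' := fun ha hb g c => by rw [map_mul, map_mul, ha g c, hb g c]
  add_mem' := fun ha hb g c => by rw [map_add, map_add, ha g c, hb g c]
  algebraMap_mem' := fun r g c => by simp [algebraMap_eq]

/-! ### Invariants as highest weight vectors of weight zero -/

section Lie

variable {σ : Type*}

theorem mem_vectorInvariants {f : MvPolynomial (σ × Fin 2) ℂ} :
    f ∈ vectorInvariants σ ↔ ∀ (g : SpecialLinearGroup (Fin 2) ℂ) (c : σ → Fin 2 → ℂ),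
      eval (fun p => (c p.1 ᵥ* (g : Matrix (Fin 2) (Fin 2) ℂ)) p.2) f =
        eval (fun p => c p.1 p.2) f := by
  refine ⟨fun h g c => ?_, fun h g c => h g⁻¹ c⟩
  have := h g⁻¹ c
  rwa [show (fun p : σ × Fin 2 => formAct g⁻¹ (c p.1) p.2) =
    fun p => (c p.1 ᵥ* (g : Matrix (Fin 2) (Fin 2) ℂ)) p.2 by simp [formAct]] at this

/-- The polarization derivation sending the `b`-th coefficient of each form to the `a`-th. -/
noncomputable def polarization (σ : Type*) (a b : Fin 2) :
    Derivation ℂ (MvPolynomial (σ × Fin 2) ℂ) (MvPolynomial (σ × Fin 2) ℂ) :=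
  mkDerivation ℂ fun p => if p.2 = b then X (p.1, a) else 0

/-- The generic shear `c b ↦ c b + s * c a` of a point, as a polynomial in `s`. -/
noncomputable def shear (a b : Fin 2) (c : σ → Fin 2 → ℂ) :
    MvPolynomial (σ × Fin 2) ℂ →ₐ[ℂ] Polynomial ℂ :=
  aeval fun p => Polynomial.C (c p.1 p.2) +
    if p.2 = b then Polynomial.X * Polynomial.C (c p.1 a) else 0

/-- Polarization is the infinitesimal generator of the shears. Both sides obey the Leibniz rule, so
only variables need checking; `a ≠ b` ensures that the shear fixes `c a`. -/
theorem derivative_shear {a b : Fin 2} (hab : a ≠ b) (c : σ → Fin 2 → ℂ)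
    (f : MvPolynomial (σ × Fin 2) ℂ) :
    Polynomial.derivative (shear a b c f) = shear a b c (polarization σ a b f) := by
  induction f using MvPolynomial.induction_on with
  | C r => simp [shear, polarization]
  | add p q hp hq => simp [hp, hq]
  | mul_X p i hp =>
    rw [map_mul, Polynomial.derivative_mul, hp, Derivation.leibniz, smul_eq_mul, smul_eq_mul,
      map_add, map_mul, map_mul]
    have : Polynomial.derivative (shear a b c (X i)) = shear a b c (polarization σ a b (X i)) := by
      simp only [shear, polarization, mkDerivation_X, aeval_X]
      split_ifs <;> simp [hab]
    rw [this]
    ring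

theorem vecMul_transvection_apply {a b : Fin 2} (hab : a ≠ b) (c : Fin 2 → ℂ) (s : ℂ) (k : Fin 2) :
    (c ᵥ* (SpecialLinearGroup.transvection hab s : Matrix (Fin 2) (Fin 2) ℂ)) k =
      c k + if k = b then s * c a else 0 := by
  rw [SpecialLinearGroup.transvection_coe]
  fin_cases a <;> fin_cases b <;> fin_cases k <;>
    first
    | exact absurd rfl hab
    | simp [Matrix.vecMul, dotProduct, Fin.sum_univ_two, Matrix.single, mul_comm, add_comm]

theorem eval_shear {a b : Fin 2} (hab : a ≠ b) (c : σ → Fin 2 → ℂ)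
    (f : MvPolynomial (σ × Fin 2) ℂ) (s : ℂ) :
    Polynomial.eval s (shear a b c f) =
      eval (fun p => (c p.1 ᵥ* (SpecialLinearGroup.transvection hab s :
        Matrix (Fin 2) (Fin 2) ℂ)) p.2) f := by
  rw [← Polynomial.coe_aeval_eq_eval, ← coe_aeval_eq_eval]
  change ((Polynomial.aeval s).comp (shear a b c)) f = (aeval _) f
  congr 1
  ext p
  rw [aeval_X, vecMul_transvection_apply]
  simp only [shear, AlgHom.comp_apply, aeval_X]
  split_ifs
  · rw [map_add, map_mul, Polynomial.aeval_C, Polynomial.aeval_C, Polynomial.aeval_X]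
    rfl
  · rw [add_zero, add_zero, Polynomial.aeval_C]
    rfl

/-- Along a shear orbit `f` is a polynomial in `s`: a zero derivative makes it constant, and
conversely the derivative at `s = 0` recovers the polarization. -/
theorem polarization_eq_zero_iff {a b : Fin 2} (hab : a ≠ b) {f : MvPolynomial (σ × Fin 2) ℂ} :
    polarization σ a b f = 0 ↔ ∀ (s : ℂ) (c : σ → Fin 2 → ℂ),
      eval (fun p => (c p.1 ᵥ* (SpecialLinearGroup.transvection hab s :
        Matrix (Fin 2) (Fin 2) ℂ)) p.2) f = eval (fun p => c p.1 p.2) f := by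
  have h0 (c : σ → Fin 2 → ℂ) (f : MvPolynomial (σ × Fin 2) ℂ) :
      Polynomial.eval 0 (shear a b c f) = eval (fun p => c p.1 p.2) f := by
    rw [eval_shear hab, SpecialLinearGroup.transvection_coe]
    simp
  constructor
  · intro h s c
    rw [← eval_shear hab, ← h0]
    have h1 : Polynomial.derivative (shear a b c f) = 0 := by
      rw [derivative_shear hab, h, map_zero]
    rw [Polynomial.eq_C_of_derivative_eq_zero h1]
    simp
  · intro h
    refine MvPolynomial.funext fun x => ?_
    let c : σ → Fin 2 → ℂ := fun i k => x (i, k)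
    have h1 : shear a b c f = Polynomial.C (eval (fun p => c p.1 p.2) f) := by
      refine Polynomial.funext fun s => ?_
      rw [eval_shear hab, h, Polynomial.eval_C]
    have h2 := h0 c (polarization σ a b f)
    rw [← derivative_shear hab, h1, Polynomial.derivative_C, Polynomial.eval_zero] at h2
    rw [map_zero]
    exact h2.symm

/-- Transvections generate `SL₂`, so invariance under the two unipotent subgroups suffices. -/
theorem mem_vectorInvariants_iff_polarization {f : MvPolynomial (σ × Fin 2) ℂ} :
    f ∈ vectorInvariants σ ↔ polarization σ 0 1 f = 0 ∧ polarization σ 1 0 f = 0 := by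
  rw [mem_vectorInvariants, polarization_eq_zero_iff zero_ne_one,
    polarization_eq_zero_iff one_ne_zero]
  refine ⟨fun h => ⟨fun s => h _, fun s => h _⟩, fun h g => ?_⟩
  induction g using Matrix.SL2.transvection_induction with
  | htransvec i j hij s =>
    intro c
    fin_cases i <;> fin_cases j
    · exact absurd rfl hij
    · exact h.1 s c
    · exact h.2 s c
    · exact absurd rfl hij
  | hmul A B hA hB =>
    intro c
    have e := hB fun i => c i ᵥ* (A : Matrix (Fin 2) (Fin 2) ℂ)
    simp only [Matrix.vecMul_vecMul] at e
    exact e.trans (hA c)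

/-- The Cartan derivation, whose eigenvectors are the polynomials of a given torus weight. -/
noncomputable def cartan (σ : Type*) :
    Derivation ℂ (MvPolynomial (σ × Fin 2) ℂ) (MvPolynomial (σ × Fin 2) ℂ) :=
  mkDerivation ℂ fun p => if p.2 = 0 then X p else -X p

theorem raising_lowering (f : MvPolynomial (σ × Fin 2) ℂ) :
    polarization σ 0 1 (polarization σ 1 0 f) =
      polarization σ 1 0 (polarization σ 0 1 f) + cartan σ f := by
  have h : ⁅polarization σ 0 1, polarization σ 1 0⁆ = cartan σ := by
    refine derivation_ext fun p => ?_
    obtain ⟨i, k⟩ := p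
    fin_cases k <;> simp [Derivation.commutator_apply, polarization, cartan]
  rw [← h, Derivation.commutator_apply]
  abel

theorem cartan_raising (f : MvPolynomial (σ × Fin 2) ℂ) :
    cartan σ (polarization σ 0 1 f) =
      polarization σ 0 1 (cartan σ f) + (2 : ℂ) • polarization σ 0 1 f := by
  have h : ⁅cartan σ, polarization σ 0 1⁆ = (2 : ℂ) • polarization σ 0 1 := by
    refine derivation_ext fun p => ?_
    obtain ⟨i, k⟩ := p
    fin_cases k <;> simp [Derivation.commutator_apply, polarization, cartan, two_smul]
  rw [← Derivation.smul_apply, ← h, Derivation.commutator_apply]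
  abel

theorem cartan_lowering (f : MvPolynomial (σ × Fin 2) ℂ) :
    cartan σ (polarization σ 1 0 f) =
      polarization σ 1 0 (cartan σ f) - (2 : ℂ) • polarization σ 1 0 f := by
  have h : ⁅cartan σ, polarization σ 1 0⁆ = -((2 : ℂ) • polarization σ 1 0) := by
    refine derivation_ext fun p => ?_
    obtain ⟨i, k⟩ := p
    fin_cases k <;> simp [Derivation.commutator_apply, polarization, cartan, two_smul]
    abel
  rw [← Derivation.smul_apply, sub_eq_add_neg, ← Derivation.neg_apply, ← h,
    Derivation.commutator_apply]
  abel

/-- The multidegree of a monomial: its degree in the coefficients of each form. -/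
def multideg (m : σ × Fin 2 →₀ ℕ) (i : σ) : ℕ := m (i, 0) + m (i, 1)

theorem polarization_monomial_mem {a b : Fin 2} (hab : a ≠ b) (m : σ × Fin 2 →₀ ℕ) (r : ℂ) :
    polarization σ a b (monomial m r) ∈ restrictSupport ℂ {m' | multideg m' = multideg m} := by
  classical
  rw [polarization, mkDerivation_monomial]
  refine Submodule.smul_mem _ _ (Submodule.sum_mem _ fun p hp => ?_)
  obtain ⟨i, k⟩ := p
  have hp' : m (i, k) ≠ 0 := by simpa using hp
  dsimp only
  split_ifs with hk
  · subst hk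
    rw [X, smul_eq_mul, monomial_mul, monomial_mem_restrictSupport]
    left
    funext j
    by_cases hj : j = i
    · subst hj
      fin_cases a <;> fin_cases k <;> simp [multideg] at hab hp' ⊢ <;> omega
    · simp [multideg, Ne.symm hj]
  · simp

theorem polarization_mem {a b : Fin 2} (hab : a ≠ b) (Δ : Set (σ → ℕ))
    {f : MvPolynomial (σ × Fin 2) ℂ} (hf : f ∈ restrictSupport ℂ (multideg ⁻¹' Δ)) :
    polarization σ a b f ∈ restrictSupport ℂ (multideg ⁻¹' Δ) := by
  rw [restrictSupport_eq_span] at hf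
  induction hf using Submodule.span_induction with
  | mem x hx =>
    obtain ⟨m, hm, rfl⟩ := hx
    refine restrictSupport_mono ℂ ?_ (polarization_monomial_mem hab m 1)
    intro m' hm'
    rw [Set.mem_preimage, show multideg m' = multideg m from hm']
    exact hm
  | zero => rw [map_zero]; exact Submodule.zero_mem _
  | add x y _ _ hx hy => rw [map_add]; exact Submodule.add_mem _ hx hy
  | smul c x _ hx => rw [Derivation.map_smul]; exact Submodule.smul_mem _ _ hx

theorem polarization_pow_mem {a b : Fin 2} (hab : a ≠ b) (Δ : Set (σ → ℕ)) (k : ℕ)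
    {f : MvPolynomial (σ × Fin 2) ℂ} (hf : f ∈ restrictSupport ℂ (multideg ⁻¹' Δ)) :
    ((polarization σ a b).toLinearMap ^ k) f ∈ restrictSupport ℂ (multideg ⁻¹' Δ) := by
  induction k with
  | zero => simpa using hf
  | succ k ih =>
    rw [pow_succ', Module.End.mul_apply]
    exact polarization_mem hab Δ ih

variable [Fintype σ]

/-- The weight of a monomial under the diagonal torus. -/
def weight (m : σ × Fin 2 →₀ ℕ) : ℤ := ∑ i, ((m (i, 0) : ℤ) - m (i, 1))

theorem cartan_monomial (m : σ × Fin 2 →₀ ℕ) (r : ℂ) :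
    cartan σ (monomial m r) = (weight m : ℂ) • monomial m r := by
  classical
  rw [cartan, mkDerivation_monomial, Finsupp.sum_fintype _ _ (by simp)]
  have h (p : σ × Fin 2) : monomial (m - Finsupp.single p 1) ((m p : ℕ) : ℂ) •
      (if p.2 = 0 then X p else -X p : MvPolynomial (σ × Fin 2) ℂ) =
        ((if p.2 = 0 then 1 else -1 : ℂ) * m p) • monomial m 1 := by
    have e : monomial (m - Finsupp.single p 1) ((m p : ℕ) : ℂ) * X p =
        (m p : ℂ) • monomial m 1 := by
      rw [X, monomial_mul, smul_monomial]
      by_cases hp : m p = 0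
      · simp [hp]
      · rw [tsub_add_cancel_of_le (Finsupp.single_le_iff.2 (Nat.one_le_iff_ne_zero.2 hp))]
        simp
    split_ifs
    · rw [smul_eq_mul, e, one_mul]
    · rw [smul_eq_mul, mul_neg, e, neg_one_mul, neg_smul]
  rw [Finset.sum_congr rfl fun p _ => h p, ← Finset.sum_smul, smul_smul, smul_monomial,
    smul_monomial]
  congr 1
  rw [Fintype.sum_prod_type, weight]
  simp only [Fin.sum_univ_two]
  push_cast
  simp [sub_eq_add_neg, mul_comm]

theorem coeff_cartan (m : σ × Fin 2 →₀ ℕ) (f : MvPolynomial (σ × Fin 2) ℂ) :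
    coeff m (cartan σ f) = weight m * coeff m f := by
  classical
  induction f using MvPolynomial.monomial_add_induction_on with
  | C a => simp [← monomial_zero', cartan_monomial, coeff_monomial]; split_ifs with h; exacts [by rw [h], rfl]
  | monomial_add a b f _ _ ih =>
    rw [map_add, coeff_add, coeff_add, ih, cartan_monomial, coeff_smul, coeff_monomial]
    split_ifs with h
    · subst h; rw [smul_eq_mul]; ring
    · simp

theorem cartan_eq_smul_iff {f : MvPolynomial (σ × Fin 2) ℂ} {μ : ℤ} :
    cartan σ f = (μ : ℂ) • f ↔ f ∈ restrictSupport ℂ {m | weight m = μ} := by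
  rw [mem_restrictSupport_iff, MvPolynomial.ext_iff]
  refine forall_congr' fun m => ?_
  rw [coeff_cartan, coeff_smul, smul_eq_mul, mul_eq_mul_right_iff, Finset.mem_coe, mem_support_iff,
    Set.mem_ofPred_eq, Int.cast_inj]
  tauto

theorem abs_weight_le (m : σ × Fin 2 →₀ ℕ) : |weight m| ≤ ∑ i, multideg m i := by
  rw [weight]
  push_cast
  refine (Finset.abs_sum_le_sum_abs _ _).trans (Finset.sum_le_sum fun i _ => ?_)
  simp only [multideg]
  push_cast
  rw [abs_le]
  constructor <;> omega

theorem exists_mem_bounded (f : MvPolynomial (σ × Fin 2) ℂ) :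
    ∃ N : ℕ, f ∈ restrictSupport ℂ (multideg ⁻¹' {δ : σ → ℕ | ∑ i, δ i ≤ N}) :=
  ⟨f.support.sup fun m => ∑ i, multideg m i, fun _ hm =>
    Finset.le_sup (f := fun m => ∑ i, multideg m i) hm⟩

theorem eq_zero_of_weight_gt {f : MvPolynomial (σ × Fin 2) ℂ} {μ : ℤ} {N : ℕ}
    (hf : cartan σ f = (μ : ℂ) • f)
    (hN : f ∈ restrictSupport ℂ (multideg ⁻¹' {δ : σ → ℕ | ∑ i, δ i ≤ N})) (hμ : N < |μ|) :
    f = 0 := by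
  rw [← support_eq_empty, Finset.eq_empty_iff_forall_notMem]
  intro m hm
  have h1 : weight m = μ := cartan_eq_smul_iff.1 hf hm
  have h2 : ∑ i, multideg m i ≤ N := hN hm
  have h3 := abs_weight_le m
  rw [h1] at h3
  have : ((∑ i, multideg m i : ℕ) : ℤ) ≤ N := by exact_mod_cast h2
  omega

theorem exists_raising_pow_eq_zero {f : MvPolynomial (σ × Fin 2) ℂ} {μ : ℤ}
    (hf : cartan σ f = (μ : ℂ) • f) :
    ∃ k : ℕ, ((polarization σ 0 1).toLinearMap ^ k) f = 0 := by
  obtain ⟨N, hN⟩ := exists_mem_bounded f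
  obtain ⟨M, hM⟩ : ∃ M : ℕ, |μ| ≤ M := ⟨μ.natAbs, (Int.natCast_natAbs μ).ge⟩
  -- Each raising adds 2 to the weight while the degree stays at most `N`; starting from at least
  -- `-M`, the weight now exceeds `N`.
  refine ⟨N + M + 1, eq_zero_of_weight_gt (μ := μ + 2 * (N + M + 1 : ℕ)) ?_
    (polarization_pow_mem zero_ne_one _ _ hN) ?_⟩
  · have := weight_pow (E := (polarization σ 0 1).toLinearMap) (H := (cartan σ).toLinearMap)
      cartan_raising hf (N + M + 1)
    push_cast at this ⊢
    exact this
  · rw [lt_abs]; left; push_cast; have := abs_le.1 hM; omega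

theorem exists_lowering_pow_eq_zero {f : MvPolynomial (σ × Fin 2) ℂ} {μ : ℤ}
    (hf : cartan σ f = (μ : ℂ) • f) :
    ∃ k : ℕ, ((polarization σ 1 0).toLinearMap ^ k) f = 0 := by
  obtain ⟨N, hN⟩ := exists_mem_bounded f
  obtain ⟨M, hM⟩ : ∃ M : ℕ, |μ| ≤ M := ⟨μ.natAbs, (Int.natCast_natAbs μ).ge⟩
  refine ⟨N + M + 1, eq_zero_of_weight_gt (μ := μ - 2 * (N + M + 1 : ℕ)) ?_
    (polarization_pow_mem one_ne_zero _ _ hN) ?_⟩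
  · have := weight_pow (E := (polarization σ 1 0).toLinearMap) (H := -(cartan σ).toLinearMap)
      (v := f) (μ := -μ)
      (fun v => by
        have := cartan_lowering v
        simp only [LinearMap.neg_apply, Derivation.coeFn_coe,
          map_neg, this]
        abel)
      (by
        simp only [LinearMap.neg_apply, Derivation.coeFn_coe]
        rw [hf, neg_smul]) (N + M + 1)
    rw [LinearMap.neg_apply, neg_eq_iff_eq_neg, ← neg_smul] at this
    refine Eq.trans this ?_
    congr 1
    push_cast
    ring
  · rw [lt_abs]; right; push_cast; have := abs_le.1 hM; omega

/-- If `f` has weight 0 and `E f = 0`, then `F f` has weight `-2` and `E F f = F E f + H f = 0`, so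
`F f` vanishes by `eq_zero_of_raising_eq_zero`. -/
theorem mem_vectorInvariants_iff_raising {f : MvPolynomial (σ × Fin 2) ℂ} :
    f ∈ vectorInvariants σ ↔ polarization σ 0 1 f = 0 ∧ cartan σ f = 0 := by
  rw [mem_vectorInvariants_iff_polarization]
  constructor
  · rintro ⟨h1, h2⟩
    have := raising_lowering f
    rw [h1, h2, map_zero, map_zero, zero_add] at this
    exact ⟨h1, this.symm⟩
  · rintro ⟨h1, h2⟩
    refine ⟨h1, ?_⟩
    have hw : cartan σ (polarization σ 1 0 f) = ((-2 : ℤ) : ℂ) • polarization σ 1 0 f := by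
      rw [cartan_lowering, h2, map_zero, zero_sub]
      push_cast
      rw [neg_smul]
    obtain ⟨k, hk⟩ := exists_lowering_pow_eq_zero hw
    refine eq_zero_of_raising_eq_zero (E := (polarization σ 0 1).toLinearMap)
      (F := (polarization σ 1 0).toLinearMap) (H := (cartan σ).toLinearMap) (μ := 2)
      raising_lowering cartan_lowering (fun k => by exact_mod_cast (by omega : 2 + k ≠ 0))
      (by push_cast at hw; exact hw) ?_ k hk
    have := raising_lowering f
    rw [h1, h2, map_zero, zero_add] at this
    exact this

theorem exists_raising_eq_of_weight_pos {Δ : Set (σ → ℕ)} {μ : ℤ} (hμ : 0 < μ)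
    {f : MvPolynomial (σ × Fin 2) ℂ} (hf : f ∈ restrictSupport ℂ (multideg ⁻¹' Δ))
    (hw : cartan σ f = (μ : ℂ) • f) :
    ∃ u ∈ restrictSupport ℂ (multideg ⁻¹' Δ),
      cartan σ u = ((μ - 2 : ℤ) : ℂ) • u ∧ polarization σ 0 1 u = f := by
  obtain ⟨k, hk⟩ := exists_raising_pow_eq_zero hw
  have := exists_raising_eq (E := (polarization σ 0 1).toLinearMap)
      (F := (polarization σ 1 0).toLinearMap) (H := (cartan σ).toLinearMap) (μ := μ)
      raising_lowering cartan_raising cartan_lowering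
      (p := restrictSupport ℂ (multideg ⁻¹' Δ)) (fun v => polarization_mem zero_ne_one Δ)
      (fun v => polarization_mem one_ne_zero Δ)
      (fun k => by exact_mod_cast (by omega : μ + k ≠ 0)) k hf hw hk
  push_cast
  exact this

/-- Rank–nullity for the raising operator from weight 0 onto weight 2, whose kernel is the space of
invariants. Prescribing an arbitrary finite family of multidegrees serves both gradings. -/
theorem finrank_vectorInvariants {Δ : Set (σ → ℕ)}
    (hΔ : (multideg ⁻¹' Δ : Set (σ × Fin 2 →₀ ℕ)).Finite) :
    Module.Finite ℂ ↥((vectorInvariants σ).toSubmodule ⊓ restrictSupport ℂ (multideg ⁻¹' Δ)) ∧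
    Module.finrank ℂ ↥((vectorInvariants σ).toSubmodule ⊓ restrictSupport ℂ (multideg ⁻¹' Δ)) +
      {m : σ × Fin 2 →₀ ℕ | multideg m ∈ Δ ∧ weight m = 2}.ncard =
      {m : σ × Fin 2 →₀ ℕ | multideg m ∈ Δ ∧ weight m = 0}.ncard := by
  let S (μ : ℤ) : Set (σ × Fin 2 →₀ ℕ) := {m | multideg m ∈ Δ ∧ weight m = μ}
  have hS (μ : ℤ) : (S μ).Finite := hΔ.subset fun m hm => hm.1
  have hmem (μ : ℤ) (f : MvPolynomial (σ × Fin 2) ℂ) : f ∈ restrictSupport ℂ (S μ) ↔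
      f ∈ restrictSupport ℂ (multideg ⁻¹' Δ) ∧ cartan σ f = (μ : ℂ) • f := by
    rw [cartan_eq_smul_iff, mem_restrictSupport_iff, mem_restrictSupport_iff,
      mem_restrictSupport_iff, ← Set.subset_inter_iff]
    rfl
  have hfin (μ : ℤ) : Module.Finite ℂ (restrictSupport ℂ (S μ)) :=
    have := (hS μ).to_subtype
    Module.Finite.of_basis (basisRestrictSupport ℂ (S μ))
  have hrank (μ : ℤ) : Module.finrank ℂ (restrictSupport ℂ (S μ)) = (S μ).ncard := by
    rw [Module.finrank_eq_nat_card_basis (basisRestrictSupport ℂ (S μ)), Nat.card_coe_set_eq]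
  have hmaps : ∀ f ∈ restrictSupport ℂ (S 0),
      (polarization σ 0 1).toLinearMap f ∈ restrictSupport ℂ (S 2) := by
    intro f hf
    rw [hmem] at hf ⊢
    refine ⟨polarization_mem zero_ne_one Δ hf.1, ?_⟩
    have := cartan_raising f
    rw [hf.2, Int.cast_zero, zero_smul, map_zero, zero_add] at this
    push_cast
    exact this
  let T := (polarization σ 0 1).toLinearMap.restrict hmaps
  have hsurj : Function.Surjective T := by
    rintro ⟨f, hf⟩
    rw [hmem] at hf
    obtain ⟨u, hu, hu0, huf⟩ := exists_raising_eq_of_weight_pos two_pos hf.1 hf.2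
    exact ⟨⟨u, (hmem 0 u).2 ⟨hu, by simpa using hu0⟩⟩, Subtype.ext huf⟩
  have hker : (LinearMap.ker T).map (restrictSupport ℂ (S 0)).subtype =
      (vectorInvariants σ).toSubmodule ⊓ restrictSupport ℂ (multideg ⁻¹' Δ) := by
    ext f
    simp only [Submodule.mem_map, LinearMap.mem_ker, Submodule.mem_inf, Subalgebra.mem_toSubmodule,
      mem_vectorInvariants_iff_raising, Submodule.subtype_apply]
    constructor
    · rintro ⟨⟨u, hu⟩, h, rfl⟩
      have hu' := (hmem 0 u).1 hu
      exact ⟨⟨congrArg Subtype.val h, by simpa using hu'.2⟩, hu'.1⟩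
    · rintro ⟨⟨h1, h2⟩, h3⟩
      exact ⟨⟨f, (hmem 0 f).2 ⟨h3, by simpa using h2⟩⟩, Subtype.ext h1, rfl⟩
  have hdim := T.finrank_range_add_finrank_ker
  rw [LinearMap.range_eq_top.2 hsurj, finrank_top, hrank, hrank] at hdim
  rw [← hker, Submodule.finrank_map_subtype_eq, add_comm]
  exact ⟨inferInstance, hdim⟩

end Lie

/-! ### Cancellation between weights 0 and 2 -/

section Count

variable {M : Type*} {p q : M → ℕ} {j : ℕ}

/-- Here `M` stands for monomials in the old forms, `p` and `q` for their degrees in the two kinds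
of coefficients, and the pair for the exponents of one additional form. Moving one unit between
these exponents keeps their sum and raises the weight by 2. -/
theorem ncard_shift_eq (p q : M → ℕ) (j : ℕ) (D : Set ℕ) :
    {x : M × ℕ × ℕ | (p x.1 + q x.1 = j ∧ x.2.1 + x.2.2 ∈ D ∧
      p x.1 + x.2.1 = q x.1 + x.2.2) ∧ x.2.2 ≠ 0}.ncard =
    {x : M × ℕ × ℕ | (p x.1 + q x.1 = j ∧ x.2.1 + x.2.2 ∈ D ∧
      p x.1 + x.2.1 = q x.1 + x.2.2 + 2) ∧ x.2.1 ≠ 0}.ncard := by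
  refine Set.ncard_congr (fun x _ => (x.1, x.2.1 + 1, x.2.2 - 1)) ?_ ?_ ?_
  · rintro ⟨x, u, v⟩ ⟨⟨h1, h2, h3⟩, h4⟩
    dsimp only at *
    refine ⟨⟨h1, ?_, by dsimp only; omega⟩, by dsimp only; omega⟩
    rwa [show u + 1 + (v - 1) = u + v by omega]
  · rintro ⟨x, u, v⟩ ⟨y, u', v'⟩ ⟨-, h⟩ ⟨-, h'⟩ e
    simp only [Prod.mk.injEq] at e h h' ⊢
    exact ⟨e.1, by omega, by omega⟩
  · rintro ⟨x, u, v⟩ ⟨⟨h1, h2, h3⟩, h4⟩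
    dsimp only at *
    refine ⟨(x, u - 1, v + 1), ⟨⟨h1, ?_, by dsimp only; omega⟩, by dsimp only; omega⟩, ?_⟩
    · dsimp only
      rwa [show u - 1 + (v + 1) = u + v by omega]
    · simp only [Prod.mk.injEq, true_and]; omega

theorem finite_triples (hfin : {x | p x + q x = j}.Finite) {D : Set ℕ} (hD : D.Finite) :
    {x : M × ℕ × ℕ | p x.1 + q x.1 = j ∧ x.2.1 + x.2.2 ∈ D}.Finite := by
  obtain ⟨N, hN⟩ := hD.bddAbove
  refine (hfin.prod ((Set.finite_Iic N).prod (Set.finite_Iic N))).subset ?_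
  rintro ⟨x, u, v⟩ ⟨h1, h2⟩
  have := hN h2
  dsimp only at this
  exact ⟨h1, Set.mem_Iic.2 (by dsimp only; omega), Set.mem_Iic.2 (by dsimp only; omega)⟩

/-- After the shift bijection, only weight 0 with second exponent 0 and weight 2 with first exponent
0 survive; there the remaining exponent is determined by the old monomial. -/
theorem ncard_weight_zero_eq_add (hfin : {x | p x + q x = j}.Finite) {D : Set ℕ} (hD : D.Finite) :
    {x : M × ℕ × ℕ | p x.1 + q x.1 = j ∧ x.2.1 + x.2.2 ∈ D ∧
      p x.1 + x.2.1 = q x.1 + x.2.2}.ncard + {x | p x + q x = j ∧ ∃ d ∈ D, p x = q x + d + 2}.ncard =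
    {x : M × ℕ × ℕ | p x.1 + q x.1 = j ∧ x.2.1 + x.2.2 ∈ D ∧
      p x.1 + x.2.1 = q x.1 + x.2.2 + 2}.ncard +
    {x | p x + q x = j ∧ ∃ d ∈ D, p x + d = q x}.ncard := by
  have h0 : {x : M × ℕ × ℕ | (p x.1 + q x.1 = j ∧ x.2.1 + x.2.2 ∈ D ∧
      p x.1 + x.2.1 = q x.1 + x.2.2) ∧ ¬ x.2.2 ≠ 0}.ncard =
      {x | p x + q x = j ∧ ∃ d ∈ D, p x + d = q x}.ncard := by
    refine Set.ncard_congr (fun x _ => x.1) ?_ ?_ ?_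
    · rintro ⟨x, u, v⟩ ⟨⟨h1, h2, h3⟩, h4⟩
      dsimp only at *
      obtain rfl : v = 0 := by omega
      exact ⟨h1, u, h2, h3⟩
    · rintro ⟨x, u, v⟩ ⟨y, u', v'⟩ ⟨⟨-, -, h⟩, h2⟩ ⟨⟨-, -, h'⟩, h2'⟩ (rfl : x = y)
      dsimp only at *
      simp only [Prod.mk.injEq, true_and]
      omega
    · rintro x ⟨h1, d, hd, h2⟩
      exact ⟨(x, d, 0), ⟨⟨h1, hd, h2⟩, not_not.2 rfl⟩, rfl⟩
  have h2 : {x : M × ℕ × ℕ | (p x.1 + q x.1 = j ∧ x.2.1 + x.2.2 ∈ D ∧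
      p x.1 + x.2.1 = q x.1 + x.2.2 + 2) ∧ ¬ x.2.1 ≠ 0}.ncard =
      {x | p x + q x = j ∧ ∃ d ∈ D, p x = q x + d + 2}.ncard := by
    refine Set.ncard_congr (fun x _ => x.1) ?_ ?_ ?_
    · rintro ⟨x, u, v⟩ ⟨⟨h1, h2, h3⟩, h4⟩
      dsimp only at *
      obtain rfl : u = 0 := by omega
      exact ⟨h1, v, by simpa using h2, h3⟩
    · rintro ⟨x, u, v⟩ ⟨y, u', v'⟩ ⟨⟨-, -, h⟩, h2⟩ ⟨⟨-, -, h'⟩, h2'⟩ (rfl : x = y)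
      dsimp only at *
      simp only [Prod.mk.injEq, true_and]
      omega
    · rintro x ⟨h1, d, hd, h2⟩
      exact ⟨(x, 0, d), ⟨⟨h1, by simpa using hd, h2⟩, not_not.2 rfl⟩, rfl⟩
  have hf := finite_triples hfin hD
  have s0 : {x : M × ℕ × ℕ | (p x.1 + q x.1 = j ∧ x.2.1 + x.2.2 ∈ D ∧
      p x.1 + x.2.1 = q x.1 + x.2.2) ∧ x.2.2 ≠ 0}.ncard +
      {x : M × ℕ × ℕ | (p x.1 + q x.1 = j ∧ x.2.1 + x.2.2 ∈ D ∧
      p x.1 + x.2.1 = q x.1 + x.2.2) ∧ ¬ x.2.2 ≠ 0}.ncard = _ :=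
    Set.ncard_inter_add_ncard_sdiff_eq_ncard
      {x : M × ℕ × ℕ | p x.1 + q x.1 = j ∧ x.2.1 + x.2.2 ∈ D ∧ p x.1 + x.2.1 = q x.1 + x.2.2}
      {x | x.2.2 ≠ 0} (hf.subset fun x hx => ⟨hx.1, hx.2.1⟩)
  have s2 : {x : M × ℕ × ℕ | (p x.1 + q x.1 = j ∧ x.2.1 + x.2.2 ∈ D ∧
      p x.1 + x.2.1 = q x.1 + x.2.2 + 2) ∧ x.2.1 ≠ 0}.ncard +
      {x : M × ℕ × ℕ | (p x.1 + q x.1 = j ∧ x.2.1 + x.2.2 ∈ D ∧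
      p x.1 + x.2.1 = q x.1 + x.2.2 + 2) ∧ ¬ x.2.1 ≠ 0}.ncard = _ :=
    Set.ncard_inter_add_ncard_sdiff_eq_ncard
      {x : M × ℕ × ℕ | p x.1 + q x.1 = j ∧ x.2.1 + x.2.2 ∈ D ∧ p x.1 + x.2.1 = q x.1 + x.2.2 + 2}
      {x | x.2.1 ≠ 0} (hf.subset fun x hx => ⟨hx.1, hx.2.1⟩)
  rw [← s0, ← s2, h0, h2, ncard_shift_eq p q j D]
  ring

/-- The swap `s` turns `p ≥ q + 2` into `q ≥ p + 2`. Removing these from `p ≤ q` leaves `q - p ≤ 1`,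
which `p + q = j` determines. -/
theorem ncard_balanced (hfin : {x | p x + q x = j}.Finite) (s : M ≃ M) (hs : ∀ x, p (s x) = q x)
    (hs' : ∀ x, q (s x) = p x) :
    {x | p x + q x = j ∧ ∃ d ∈ Set.Iic j, p x + d = q x}.ncard =
      {x | p x + q x = j ∧ ∃ d ∈ Set.Iic j, p x = q x + d + 2}.ncard +
        {x | p x = j / 2 ∧ q x = (j + 1) / 2}.ncard := by
  have h1 : {x | p x + q x = j ∧ ∃ d ∈ Set.Iic j, p x = q x + d + 2}.ncard =
      {x | p x + q x = j ∧ p x + 2 ≤ q x}.ncard := by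
    refine Set.ncard_congr (fun x _ => s x) ?_ (fun x y _ _ h => s.injective h) ?_
    · rintro x ⟨h1, d, -, h2⟩
      refine ⟨?_, ?_⟩ <;> rw [hs, hs'] <;> omega
    · rintro x ⟨h1, h2⟩
      obtain ⟨y, rfl⟩ := s.surjective x
      rw [hs, hs'] at h1 h2
      exact ⟨y, ⟨by omega, p y - q y - 2, Set.mem_Iic.2 (by omega), by omega⟩, rfl⟩
  rw [h1, ← Set.ncard_union_eq _ (hfin.subset fun x hx => hx.1)
    (hfin.subset fun x hx => by simp only [Set.mem_ofPred_eq] at hx ⊢; omega)]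
  · congr 1
    ext x
    simp only [Set.mem_ofPred_eq, Set.mem_union, Set.mem_Iic]
    constructor
    · rintro ⟨h, d, hd, h2⟩; omega
    · rintro (⟨h, h2⟩ | ⟨h, h2⟩)
      · exact ⟨h, q x - p x, by omega, by omega⟩
      · exact ⟨by omega, q x - p x, by omega, by omega⟩
  · rw [Set.disjoint_left]
    simp only [Set.mem_ofPred_eq]
    intro x h h'
    omega

end Count

/-! ### Counting monomials by bidegree -/

section Monomials

variable {σ : Type*} [Fintype σ]

/-- The degree of a monomial in the `k`-th coefficients of the forms. -/
def coeffDeg (k : Fin 2) (m : σ × Fin 2 →₀ ℕ) : ℕ := ∑ i, m (i, k)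

theorem sum_multideg (m : σ × Fin 2 →₀ ℕ) :
    ∑ i, multideg m i = coeffDeg 0 m + coeffDeg 1 m := by
  simp [multideg, coeffDeg, Finset.sum_add_distrib]

theorem weight_eq (m : σ × Fin 2 →₀ ℕ) : weight m = coeffDeg 0 m - coeffDeg 1 m := by
  simp [weight, coeffDeg]

theorem finite_coeffDeg_le (N : ℕ) :
    {m : σ × Fin 2 →₀ ℕ | coeffDeg 0 m + coeffDeg 1 m ≤ N}.Finite := by
  classical
  refine (Set.finite_Icc 0 (Finsupp.equivFunOnFinite.symm fun _ => N)).subset fun m hm =>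
    ⟨zero_le, ?_⟩
  rintro ⟨i, k⟩
  have hm' : coeffDeg 0 m + coeffDeg 1 m ≤ N := hm
  have h (k) : m (i, k) ≤ coeffDeg k m :=
    Finset.single_le_sum (f := fun i => m (i, k)) (fun _ _ => Nat.zero_le _) (Finset.mem_univ i)
  have h0 := h 0
  have h1 := h 1
  simp only [Finsupp.equivFunOnFinite_symm_apply_apply]
  fin_cases k <;> simp only [Fin.mk_zero, Fin.mk_one] <;> omega

/-- A monomial in the coefficients is a pair of monomials in the two kinds of coefficients. -/
noncomputable def splitEquiv (σ : Type*) [Fintype σ] :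
    (σ × Fin 2 →₀ ℕ) ≃ (σ →₀ ℕ) × (σ →₀ ℕ) where
  toFun m := (Finsupp.equivFunOnFinite.symm fun i => m (i, 0),
    Finsupp.equivFunOnFinite.symm fun i => m (i, 1))
  invFun x := Finsupp.equivFunOnFinite.symm fun p => if p.2 = 0 then x.1 p.1 else x.2 p.1
  left_inv m := by
    ext ⟨i, k⟩
    fin_cases k <;> simp
  right_inv x := by
    ext <;> simp

theorem ncard_coeffDeg (a b : ℕ) :
    {m : σ × Fin 2 →₀ ℕ | coeffDeg 0 m = a ∧ coeffDeg 1 m = b}.ncard =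
      (Fintype.card σ).multichoose a * (Fintype.card σ).multichoose b := by
  classical
  have h : {m : σ × Fin 2 →₀ ℕ | coeffDeg 0 m = a ∧ coeffDeg 1 m = b} =
      splitEquiv σ ⁻¹' ((Finset.univ.finsuppAntidiag a ×ˢ Finset.univ.finsuppAntidiag b :
        Finset ((σ →₀ ℕ) × (σ →₀ ℕ))) : Set ((σ →₀ ℕ) × (σ →₀ ℕ))) := by
    ext m
    simp [splitEquiv, coeffDeg, Finset.mem_finsuppAntidiag]
  rw [h, Set.ncard_preimage_of_injective_subset_range (splitEquiv σ).injective (by simp),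
    Set.ncard_coe_finset, Finset.card_product, Finset.card_finsuppAntidiag_nat_eq_multichoose,
    Finset.card_finsuppAntidiag_nat_eq_multichoose, Finset.card_univ]

/-- Exchange of the two coefficients of each form. -/
noncomputable def swapEquiv (σ : Type*) : (σ × Fin 2 →₀ ℕ) ≃ (σ × Fin 2 →₀ ℕ) :=
  (Finsupp.domLCongr (R := ℕ) ((Equiv.refl σ).prodCongr (Equiv.swap 0 1))).toEquiv

theorem coeffDeg_swapEquiv_zero (m : σ × Fin 2 →₀ ℕ) :
    coeffDeg 0 (swapEquiv σ m) = coeffDeg 1 m := by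
  simp [coeffDeg, swapEquiv]

theorem coeffDeg_swapEquiv_one (m : σ × Fin 2 →₀ ℕ) :
    coeffDeg 1 (swapEquiv σ m) = coeffDeg 0 m := by
  simp [coeffDeg, swapEquiv]

/-- A monomial in the coefficients of a family with one additional form. -/
noncomputable def optionEquiv (σ : Type*) [Fintype σ] :
    (Option σ × Fin 2 →₀ ℕ) ≃ (σ × Fin 2 →₀ ℕ) × ℕ × ℕ where
  toFun m := (Finsupp.equivFunOnFinite.symm fun p => m (some p.1, p.2), m (none, 0), m (none, 1))
  invFun x := Finsupp.equivFunOnFinite.symm fun p =>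
    p.1.elim (if p.2 = 0 then x.2.1 else x.2.2) fun i => x.1 (i, p.2)
  left_inv m := by
    ext ⟨i, k⟩
    cases i <;> fin_cases k <;> simp
  right_inv x := by
    ext <;> simp

end Monomials

/-! ### Dimensions of the graded pieces -/

section Dimension

variable {σ : Type*} [Fintype σ]

/-- The joint invariants whose multidegree lies in a given set. -/
noncomputable def multidegInvariants (Δ : Set (σ → ℕ)) :
    Submodule ℂ (MvPolynomial (σ × Fin 2) ℂ) :=
  (vectorInvariants σ).toSubmodule ⊓ restrictSupport ℂ (multideg ⁻¹' Δ)

theorem finite_multideg_sum (j : ℕ) :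
    (multideg ⁻¹' {δ : σ → ℕ | ∑ i, δ i = j} : Set (σ × Fin 2 →₀ ℕ)).Finite :=
  (finite_coeffDeg_le j).subset fun m hm => by
    rw [Set.mem_ofPred_eq, ← sum_multideg]
    exact le_of_eq hm

theorem finite_multidegInvariants_sum (j : ℕ) :
    Module.Finite ℂ (multidegInvariants {δ : σ → ℕ | ∑ i, δ i = j}) :=
  (finrank_vectorInvariants (finite_multideg_sum j)).1

theorem setOf_sum_multideg_weight {j : ℕ} {μ : ℤ} {a b : ℕ} (hj : a + b = j)
    (hμ : (a : ℤ) - b = μ) :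
    {m : σ × Fin 2 →₀ ℕ | multideg m ∈ {δ : σ → ℕ | ∑ i, δ i = j} ∧ weight m = μ} =
      {m | coeffDeg 0 m = a ∧ coeffDeg 1 m = b} := by
  ext m
  simp only [Set.mem_ofPred_eq, sum_multideg, weight_eq]
  omega

theorem finrank_multidegInvariants_even (m : ℕ) :
    Module.finrank ℂ (multidegInvariants {δ : σ → ℕ | ∑ i, δ i = 2 * (m + 1)}) +
      (Fintype.card σ).multichoose (m + 2) * (Fintype.card σ).multichoose m =
      (Fintype.card σ).multichoose (m + 1) * (Fintype.card σ).multichoose (m + 1) := by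
  have h := (finrank_vectorInvariants (finite_multideg_sum (σ := σ) (2 * (m + 1)))).2
  rw [setOf_sum_multideg_weight (a := m + 2) (b := m) (by omega) (by push_cast; ring),
    setOf_sum_multideg_weight (a := m + 1) (b := m + 1) (by omega) (by push_cast; ring),
    ncard_coeffDeg, ncard_coeffDeg] at h
  exact h

theorem finrank_multidegInvariants_odd (m : ℕ) :
    Module.finrank ℂ (multidegInvariants {δ : σ → ℕ | ∑ i, δ i = 2 * m + 1}) = 0 := by
  have h := (finrank_vectorInvariants (finite_multideg_sum (σ := σ) (2 * m + 1))).2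
  have h0 : {μ : σ × Fin 2 →₀ ℕ | multideg μ ∈ {δ : σ → ℕ | ∑ i, δ i = 2 * m + 1} ∧
      weight μ = 0} = ∅ := by
    ext μ
    simp only [Set.mem_ofPred_eq, sum_multideg, weight_eq, Set.mem_empty_iff_false, iff_false]
    omega
  rw [h0, Set.ncard_empty] at h
  exact (Nat.add_eq_zero_iff.1 h).1

theorem finrank_multidegInvariants_zero :
    Module.finrank ℂ (multidegInvariants {δ : σ → ℕ | ∑ i, δ i = 0}) = 1 := by
  have h := (finrank_vectorInvariants (finite_multideg_sum (σ := σ) 0)).2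
  have h0 : {μ : σ × Fin 2 →₀ ℕ | multideg μ ∈ {δ : σ → ℕ | ∑ i, δ i = 0} ∧
      weight μ = 2} = ∅ := by
    ext μ
    simp only [Set.mem_ofPred_eq, sum_multideg, weight_eq, Set.mem_empty_iff_false, iff_false]
    omega
  rw [h0, Set.ncard_empty, setOf_sum_multideg_weight (μ := 0) (a := 0) (b := 0) (add_zero 0)
    (by simp),
    ncard_coeffDeg, Nat.multichoose_zero_right, add_zero] at h
  exact h

/-- Multidegrees of total degree `j` in the old forms and degree in `D` in the additional form. -/
def orderedDegrees (σ : Type*) [Fintype σ] (j : ℕ) (D : Set ℕ) : Set (Option σ → ℕ) :=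
  {δ | ∑ i, δ (some i) = j ∧ δ none ∈ D}

theorem mem_orderedDegrees_iff {j : ℕ} {D : Set ℕ} {m : Option σ × Fin 2 →₀ ℕ} :
    multideg m ∈ orderedDegrees σ j D ↔
      coeffDeg 0 (optionEquiv σ m).1 + coeffDeg 1 (optionEquiv σ m).1 = j ∧
        (optionEquiv σ m).2.1 + (optionEquiv σ m).2.2 ∈ D := by
  simp [orderedDegrees, multideg, coeffDeg, optionEquiv, Finset.sum_add_distrib]

theorem weight_optionEquiv (m : Option σ × Fin 2 →₀ ℕ) :
    weight m = (coeffDeg 0 (optionEquiv σ m).1 + (optionEquiv σ m).2.1 : ℤ) -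
      (coeffDeg 1 (optionEquiv σ m).1 + (optionEquiv σ m).2.2) := by
  simp [weight, coeffDeg, optionEquiv, Fintype.sum_option]
  ring

theorem finite_orderedDegrees (j : ℕ) {D : Set ℕ} (hD : D.Finite) :
    (multideg ⁻¹' orderedDegrees σ j D : Set (Option σ × Fin 2 →₀ ℕ)).Finite := by
  have h := finite_triples (M := σ × Fin 2 →₀ ℕ) (p := coeffDeg 0) (q := coeffDeg 1) (j := j)
    ((finite_coeffDeg_le j).subset fun m hm => le_of_eq hm) hD
  refine (h.preimage (f := optionEquiv σ) (optionEquiv σ).injective.injOn).subset fun m hm => ?_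
  exact mem_orderedDegrees_iff.1 hm

theorem finrank_orderedDegrees (j : ℕ) {D : Set ℕ} (hD : D.Finite) :
    Module.finrank ℂ (multidegInvariants (orderedDegrees σ j D)) +
      {m : σ × Fin 2 →₀ ℕ | coeffDeg 0 m + coeffDeg 1 m = j ∧
        ∃ d ∈ D, coeffDeg 0 m = coeffDeg 1 m + d + 2}.ncard =
      {m : σ × Fin 2 →₀ ℕ | coeffDeg 0 m + coeffDeg 1 m = j ∧
        ∃ d ∈ D, coeffDeg 0 m + d = coeffDeg 1 m}.ncard := by
  have h1 := (finrank_vectorInvariants (finite_orderedDegrees (σ := σ) j hD)).2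
  have h2 := ncard_weight_zero_eq_add (M := σ × Fin 2 →₀ ℕ) (p := coeffDeg 0) (q := coeffDeg 1)
    (j := j) ((finite_coeffDeg_le j).subset fun m hm => le_of_eq hm) hD
  have e0 : {m : Option σ × Fin 2 →₀ ℕ | multideg m ∈ orderedDegrees σ j D ∧ weight m = 0} =
      optionEquiv σ ⁻¹' {x | coeffDeg 0 x.1 + coeffDeg 1 x.1 = j ∧ x.2.1 + x.2.2 ∈ D ∧
        coeffDeg 0 x.1 + x.2.1 = coeffDeg 1 x.1 + x.2.2} := by
    ext m
    rw [Set.mem_ofPred_eq, mem_orderedDegrees_iff, weight_optionEquiv, and_assoc]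
    refine and_congr_right fun _ => and_congr_right fun _ => ?_
    omega
  have e2 : {m : Option σ × Fin 2 →₀ ℕ | multideg m ∈ orderedDegrees σ j D ∧ weight m = 2} =
      optionEquiv σ ⁻¹' {x | coeffDeg 0 x.1 + coeffDeg 1 x.1 = j ∧ x.2.1 + x.2.2 ∈ D ∧
        coeffDeg 0 x.1 + x.2.1 = coeffDeg 1 x.1 + x.2.2 + 2} := by
    ext m
    rw [Set.mem_ofPred_eq, mem_orderedDegrees_iff, weight_optionEquiv, and_assoc]
    refine and_congr_right fun _ => and_congr_right fun _ => ?_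
    omega
  rw [e0, e2, Set.ncard_preimage_of_injective_subset_range (optionEquiv σ).injective (by simp),
    Set.ncard_preimage_of_injective_subset_range (optionEquiv σ).injective (by simp)] at h1
  change Module.finrank ℂ (multidegInvariants (orderedDegrees σ j D)) + _ = _ at h1
  omega

theorem finrank_orderedDegrees_Iic (j : ℕ) :
    Module.finrank ℂ (multidegInvariants (orderedDegrees σ j (Set.Iic j))) =
      (Fintype.card σ).multichoose (j / 2) * (Fintype.card σ).multichoose ((j + 1) / 2) := by
  have h1 := finrank_orderedDegrees (σ := σ) j (Set.finite_Iic j)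
  rw [ncard_balanced ((finite_coeffDeg_le j).subset fun m hm => le_of_eq hm) (swapEquiv σ)
    coeffDeg_swapEquiv_zero coeffDeg_swapEquiv_one, ncard_coeffDeg] at h1
  omega

/-- The order of a covariant is at most its degree: `p + d = q` is impossible when `p + q = j < d`.
-/
theorem multidegInvariants_eq_bot {j d : ℕ} (hd : j < d) :
    multidegInvariants (orderedDegrees σ j {d}) = ⊥ := by
  have h1 := finrank_orderedDegrees (σ := σ) j (Set.finite_singleton d)
  have e : {m : σ × Fin 2 →₀ ℕ | coeffDeg 0 m + coeffDeg 1 m = j ∧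
        ∃ d' ∈ ({d} : Set ℕ), coeffDeg 0 m + d' = coeffDeg 1 m} = ∅ := by
    refine Set.eq_empty_of_forall_notMem ?_
    rintro m ⟨h, d', rfl, h'⟩
    omega
  rw [e, Set.ncard_empty] at h1
  have hfin : Module.Finite ℂ (multidegInvariants (orderedDegrees σ j {d})) :=
    (finrank_vectorInvariants (finite_orderedDegrees (σ := σ) j (Set.finite_singleton d))).1
  exact Submodule.finrank_eq_zero.1 (Nat.add_eq_zero_iff.1 h1).1

theorem weight_comp_fst (w : σ → ℕ) (m : σ × Fin 2 →₀ ℕ) :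
    Finsupp.weight (fun p => w p.1) m = ∑ i, multideg m i * w i := by
  rw [Finsupp.weight_apply, Finsupp.sum_fintype _ _ (by simp), Fintype.sum_prod_type]
  simp [multideg, add_mul]

theorem polarization_weightedHomogeneousComponent {a b : Fin 2} (hab : a ≠ b) (w : σ → ℕ) (d : ℕ)
    (f : MvPolynomial (σ × Fin 2) ℂ) :
    polarization σ a b (weightedHomogeneousComponent (fun p => w p.1) d f) =
      weightedHomogeneousComponent (fun p => w p.1) d (polarization σ a b f) := by
  have key (m : σ × Fin 2 →₀ ℕ) (r : ℂ) :
      polarization σ a b (weightedHomogeneousComponent (fun p => w p.1) d (monomial m r)) =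
        weightedHomogeneousComponent (fun p => w p.1) d (polarization σ a b (monomial m r)) := by
    have h1 := isWeightedHomogeneous_monomial (R := ℂ) (fun p : σ × Fin 2 => w p.1) m r rfl
    have h2 : IsWeightedHomogeneous (fun p : σ × Fin 2 => w p.1)
        (polarization σ a b (monomial m r)) (Finsupp.weight (fun p => w p.1) m) := by
      intro m' hm'
      have : multideg m' = multideg m :=
        polarization_monomial_mem hab m r (mem_support_iff.2 hm')
      rw [weight_comp_fst, weight_comp_fst, this]
    rw [weightedHomogeneousComponent_of_mem h1, weightedHomogeneousComponent_of_mem h2]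
    split_ifs
    · rfl
    · rw [map_zero]
  induction f using MvPolynomial.monomial_add_induction_on with
  | C r => exact key 0 r
  | monomial_add m r f _ _ ih => rw [map_add, map_add, map_add, map_add, ih, key]

theorem weightedHomogeneousComponent_mem_vectorInvariants (w : σ → ℕ) (d : ℕ)
    {f : MvPolynomial (σ × Fin 2) ℂ} (hf : f ∈ vectorInvariants σ) :
    weightedHomogeneousComponent (fun p : σ × Fin 2 => w p.1) d f ∈ vectorInvariants σ := by
  rw [mem_vectorInvariants_iff_polarization] at hf ⊢
  rw [polarization_weightedHomogeneousComponent zero_ne_one,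
    polarization_weightedHomogeneousComponent one_ne_zero, hf.1, hf.2, map_zero]
  exact ⟨rfl, rfl⟩

/-- With the order unrestricted there are infinitely many monomials, so the rank formula does not
apply directly. Homogeneous components in the additional form are again invariant, and those of
order above `j` vanish. -/
theorem multidegInvariants_univ_eq (j : ℕ) :
    multidegInvariants (orderedDegrees σ j Set.univ) =
      multidegInvariants (orderedDegrees σ j (Set.Iic j)) := by
  refine le_antisymm ?_ (inf_le_inf_left _ (restrictSupport_mono ℂ fun m hm =>
    ⟨hm.1, trivial⟩))
  rintro f ⟨hf, hfj⟩
  refine ⟨hf, fun m hm => ⟨(hfj hm).1, ?_⟩⟩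
  by_contra hd
  rw [Set.mem_Iic, not_le] at hd
  -- This weight counts only the degree in the additional form, i.e. the order.
  set w : Option σ → ℕ := fun i => i.elim 1 fun _ => 0 with hw
  have hwt (m : Option σ × Fin 2 →₀ ℕ) :
      Finsupp.weight (fun p => w p.1) m = multideg m none := by
    rw [weight_comp_fst, Fintype.sum_option]
    simp [hw]
  have h0 : weightedHomogeneousComponent (fun p => w p.1) (multideg m none) f = 0 := by
    rw [← Submodule.mem_bot ℂ, ← multidegInvariants_eq_bot hd]
    refine ⟨weightedHomogeneousComponent_mem_vectorInvariants w _ hf, fun m' hm' => ?_⟩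
    classical
    have hm₀ : coeff m' (weightedHomogeneousComponent (fun p => w p.1) (multideg m none) f) ≠ 0 :=
      mem_support_iff.1 hm'
    rw [coeff_weightedHomogeneousComponent, hwt, ite_ne_right_iff] at hm₀
    exact ⟨(hfj (mem_support_iff.2 hm₀.2)).1, hm₀.1⟩
  have h1 := congrArg (coeff m) h0
  classical
  rw [coeff_weightedHomogeneousComponent, if_pos (hwt m), coeff_zero] at h1
  exact mem_support_iff.1 hm h1

theorem finite_multidegInvariants_univ (j : ℕ) :
    Module.Finite ℂ (multidegInvariants (orderedDegrees σ j Set.univ)) := by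
  rw [multidegInvariants_univ_eq]
  exact (finrank_vectorInvariants (finite_orderedDegrees (σ := σ) j (Set.finite_Iic j))).1

theorem finrank_multidegInvariants_univ (j : ℕ) :
    Module.finrank ℂ (multidegInvariants (orderedDegrees σ j Set.univ)) =
      (Fintype.card σ).multichoose (j / 2) * (Fintype.card σ).multichoose ((j + 1) / 2) := by
  rw [multidegInvariants_univ_eq, finrank_orderedDegrees_Iic]

end Dimension

/-! ### Transcendence degrees -/

theorem trdeg_fractionRing (R : Type*) [CommRing R] [IsDomain R] [Algebra ℂ R] :
    Algebra.trdeg ℂ (FractionRing R) = Algebra.trdeg ℂ R := by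
  have : Algebra.IsAlgebraic R (FractionRing R) := IsLocalization.isAlgebraic _ (nonZeroDivisors R)
  have hi := IsFractionRing.injective R (FractionRing R)
  have : FaithfulSMul R (FractionRing R) := (faithfulSMul_iff_algebraMap_injective _ _).2 hi
  have : FaithfulSMul ℂ R :=
    (faithfulSMul_iff_algebraMap_injective _ _).2 (algebraMap ℂ R).injective
  rw [← trdeg_add_eq ℂ R (A := FractionRing R),
    trdeg_eq_zero (R := R) (A := FractionRing R), add_zero]

theorem trdeg_eq_of_injective_of_isAlgebraic {R S : Type} [CommRing R] [IsDomain R] [Algebra ℂ R]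
    [CommRing S] [IsDomain S] [Algebra ℂ S] (f : R →ₐ[ℂ] S) (hf : Function.Injective f)
    (halg : letI := f.toRingHom.toAlgebra; Algebra.IsAlgebraic R S) :
    Algebra.trdeg ℂ R = Algebra.trdeg ℂ S := by
  let := f.toRingHom.toAlgebra
  have := halg
  have : IsScalarTower ℂ R S := IsScalarTower.of_algebraMap_eq fun x => (f.commutes x).symm
  have : FaithfulSMul R S := (faithfulSMul_iff_algebraMap_injective _ _).2 hf
  have : FaithfulSMul ℂ R :=
    (faithfulSMul_iff_algebraMap_injective _ _).2 (algebraMap ℂ R).injective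
  rw [← trdeg_add_eq ℂ R (A := S), trdeg_eq_zero (R := R) (A := S), add_zero]

section Slice

variable {σ : Type}

/-- The bracket invariant of the forms with indices `i` and `j`. -/
noncomputable def bracket (i j : σ) : MvPolynomial (σ × Fin 2) ℂ :=
  X (i, 0) * X (j, 1) - X (i, 1) * X (j, 0)

theorem bracket_mem (i j : σ) : bracket i j ∈ vectorInvariants σ := by
  rw [mem_vectorInvariants_iff_polarization]
  constructor <;> simp [bracket, polarization] <;> ring

/-- Coordinates on the normal form of a family whose forms `i₀`, `i₁` are independent. -/
abbrev SliceIndex (i₀ i₁ : σ) : Type := Option ({i : σ // i ≠ i₀ ∧ i ≠ i₁} × Fin 2)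

theorem card_sliceIndex [Fintype σ] {i₀ i₁ : σ} (h : i₀ ≠ i₁) :
    Nat.card (SliceIndex i₀ i₁) = 2 * (Fintype.card σ - 2) + 1 := by
  classical
  rw [Nat.card_eq_fintype_card, Fintype.card_option, Fintype.card_prod, Fintype.card_fin,
    Fintype.card_subtype, mul_comm]
  congr 2
  have : (Finset.univ.filter fun i => i ≠ i₀ ∧ i ≠ i₁) = Finset.univ \ {i₀, i₁} := by
    ext i
    simp
  rw [this, Finset.card_sdiff_of_subset (Finset.subset_univ _), Finset.card_univ,
    Finset.card_pair h]

open Classical in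
/-- Restriction of polynomials to families with `i₀`-th form `X` and `i₁`-th form a multiple
of `Y`. -/
noncomputable def slice (i₀ i₁ : σ) :
    MvPolynomial (σ × Fin 2) ℂ →ₐ[ℂ] MvPolynomial (SliceIndex i₀ i₁) ℂ :=
  aeval fun p =>
    if h : p.1 ≠ i₀ ∧ p.1 ≠ i₁ then X (some (⟨p.1, h⟩, p.2))
    else if p.1 = i₀ then if p.2 = 0 then 1 else 0
    else if p.2 = 0 then 0 else X none

variable {i₀ i₁ : σ}

theorem slice_X_fst (k : Fin 2) : slice i₀ i₁ (X (i₀, k)) = if k = 0 then 1 else 0 := by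
  simp [slice]

theorem slice_X_snd (h : i₀ ≠ i₁) (k : Fin 2) :
    slice i₀ i₁ (X (i₁, k)) = if k = 0 then 0 else X none := by
  simp [slice, h.symm]

theorem slice_X (i : {i : σ // i ≠ i₀ ∧ i ≠ i₁}) (k : Fin 2) :
    slice i₀ i₁ (X (i.1, k)) = X (some (i, k)) := by
  simp [slice, i.2]

theorem eval_eq_zero_of_slice_eq_zero (h : i₀ ≠ i₁) {f : MvPolynomial (σ × Fin 2) ℂ}
    (hf : f ∈ vectorInvariants σ) (hs : slice i₀ i₁ f = 0) (c : σ → Fin 2 → ℂ)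
    (ht : c i₀ 0 * c i₁ 1 - c i₀ 1 * c i₁ 0 ≠ 0) : eval (fun p => c p.1 p.2) f = 0 := by
  set t := c i₀ 0 * c i₁ 1 - c i₀ 1 * c i₁ 0 with htdef
  -- The matrix taking the row `c i₀` to `(1, 0)` and `c i₁` to `(0, t)`; it moves the family into
  -- the slice.
  let g : SpecialLinearGroup (Fin 2) ℂ :=
    ⟨!![c i₁ 1 / t, -c i₀ 1; -c i₁ 0 / t, c i₀ 0], by
      rw [det_fin_two_of]; field_simp; rw [htdef]; ring⟩
  let y : SliceIndex i₀ i₁ → ℂ := fun s => s.elim t fun p => (c p.1.1 ᵥ* g.1) p.2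
  rw [← mem_vectorInvariants.1 hf g c]
  have hy : (eval y).comp (slice i₀ i₁ : MvPolynomial (σ × Fin 2) ℂ →+* _) =
      eval fun p => (c p.1 ᵥ* g.1) p.2 := by
    refine MvPolynomial.ringHom_ext (fun r => by simp) fun p => ?_
    obtain ⟨i, k⟩ := p
    rw [eval_X, RingHom.comp_apply, RingHom.coe_coe]
    by_cases h0 : i = i₀
    · subst h0
      rw [slice_X_fst]
      fin_cases k <;> simp [g, Matrix.vecMul, dotProduct, Fin.sum_univ_two]
      · field_simp; rw [htdef]; ring
      · ring
    by_cases h1 : i = i₁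
    · subst h1
      rw [slice_X_snd h]
      fin_cases k <;> simp [g, y, Matrix.vecMul, dotProduct, Fin.sum_univ_two]
      · ring
      · rw [htdef]; ring
    · exact (congrArg (eval y) (slice_X ⟨i, h0, h1⟩ k)).trans (by simp [y])
  have := congrArg (eval y) hs
  rw [map_zero] at this
  exact (RingHom.congr_fun hy f).symm.trans this

/-- Every family with nonzero bracket can be moved into the slice, so an invariant vanishing there
becomes zero after multiplication by the bracket. -/
theorem slice_injective (h : i₀ ≠ i₁) :
    Function.Injective ((slice i₀ i₁).comp (vectorInvariants σ).val) := by
  classical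
  rw [injective_iff_map_eq_zero]
  rintro ⟨f, hf⟩ hs
  have h1 : f * bracket i₀ i₁ = 0 := by
    refine MvPolynomial.funext fun x => ?_
    rw [map_mul, map_zero, mul_eq_zero]
    by_cases ht : x (i₀, 0) * x (i₁, 1) - x (i₀, 1) * x (i₁, 0) = 0
    · right; simpa [bracket] using ht
    · left; exact eval_eq_zero_of_slice_eq_zero h hf hs (fun i k => x (i, k)) ht
  have h2 : bracket i₀ i₁ ≠ 0 := by
    intro h2
    have h3 := congrArg (slice i₀ i₁) h2
    simp [bracket, slice_X_fst, slice_X_snd h, X_ne_zero] at h3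
  exact Subtype.ext ((mul_eq_zero.1 h1).resolve_right h2)

/-- With `t` the variable `X none`, brackets restrict to `t`, to the second coordinates, and to `-t`
times the first coordinates; dividing by the algebraic element `t` reaches every variable. -/
theorem slice_isAlgebraic (h : i₀ ≠ i₁) :
    letI := ((slice i₀ i₁).comp (vectorInvariants σ).val).toRingHom.toAlgebra
    Algebra.IsAlgebraic (vectorInvariants σ) (MvPolynomial (SliceIndex i₀ i₁) ℂ) := by
  let := ((slice i₀ i₁).comp (vectorInvariants σ).val).toRingHom.toAlgebra
  have hmap (f : vectorInvariants σ) :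
      IsAlgebraic (vectorInvariants σ) (slice i₀ i₁ (f : MvPolynomial (σ × Fin 2) ℂ)) :=
    isAlgebraic_algebraMap (A := MvPolynomial (SliceIndex i₀ i₁) ℂ) f
  have hnone : IsAlgebraic (vectorInvariants σ) (X none : MvPolynomial (SliceIndex i₀ i₁) ℂ) := by
    have := hmap ⟨_, bracket_mem i₀ i₁⟩
    simpa [bracket, slice_X_fst, slice_X_snd h] using this
  refine ⟨fun f => ?_⟩
  induction f using MvPolynomial.induction_on with
  | C r =>
    have := hmap (algebraMap ℂ _ r)
    rwa [show slice i₀ i₁ ((algebraMap ℂ (vectorInvariants σ) r : vectorInvariants σ) :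
      MvPolynomial (σ × Fin 2) ℂ) = C r from (slice i₀ i₁).commutes r] at this
  | add p q hp hq => exact hp.add hq
  | mul_X p s hp =>
    refine hp.mul ?_
    match s with
    | none => exact hnone
    | some (i, k) =>
      fin_cases k
      · have h1 := hmap ⟨_, bracket_mem i₁ i.1⟩
        have h2 : slice i₀ i₁ (bracket i₁ i.1) = X none * -X (some (i, 0)) := by
          simp [bracket, slice_X_snd h, slice_X]
        rw [h2] at h1
        have h3 := IsAlgebraic.of_mul (mem_nonZeroDivisors_of_ne_zero (X_ne_zero none)) hnone
          h1
        simpa using h3.neg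
      · have := hmap ⟨_, bracket_mem i₀ i.1⟩
        simpa [bracket, slice_X_fst, slice_X] using this

theorem trdeg_vectorInvariants [Fintype σ] (h : i₀ ≠ i₁) :
    Algebra.trdeg ℂ (vectorInvariants σ) = (2 * (Fintype.card σ - 2) + 1 : ℕ) := by
  rw [trdeg_eq_of_injective_of_isAlgebraic _ (slice_injective h) (slice_isAlgebraic h),
    MvPolynomial.trdeg_of_isDomain, Cardinal.lift_id, ← card_sliceIndex h, Nat.cast_card]

/-- `SL₂` is transitive on nonzero vectors, so an invariant of one form is constant. Multiplying by
the first coefficient restricts attention to points where it is nonzero. -/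
theorem vectorInvariants_eq_bot [Unique σ] : vectorInvariants σ = ⊥ := by
  rw [eq_bot_iff]
  intro f hf
  rw [Algebra.mem_bot]
  set r := eval (fun p : σ × Fin 2 => if p.2 = 0 then 1 else 0) f with hr
  refine ⟨r, ?_⟩
  have h1 : (f - C r) * X (default, 0) = 0 := by
    refine MvPolynomial.funext fun x => ?_
    rw [map_mul, map_sub, eval_C, eval_X, map_zero, mul_eq_zero, sub_eq_zero]
    by_cases hx : x (default, 0) = 0
    · right; exact hx
    · left
      let g : SpecialLinearGroup (Fin 2) ℂ :=
        ⟨!![1 / x (default, 0), -x (default, 1); 0, x (default, 0)], by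
          rw [det_fin_two_of]; field_simp; ring⟩
      have h2 := mem_vectorInvariants.1 hf g fun i k => x (i, k)
      refine h2.symm.trans ?_
      rw [hr]
      congr 2
      funext p
      obtain ⟨i, k⟩ := p
      obtain rfl := Unique.eq_default i
      fin_cases k <;> simp [g, Matrix.vecMul, dotProduct, Fin.sum_univ_two, hx]
      ring
  exact (sub_eq_zero.1 ((mul_eq_zero.1 h1).resolve_right (X_ne_zero _))).symm

theorem trdeg_vectorInvariants_unique [Unique σ] : Algebra.trdeg ℂ (vectorInvariants σ) = 0 := by
  rw [vectorInvariants_eq_bot, (Algebra.botEquiv ℂ _).trdeg_eq, trdeg_eq_zero]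

end Slice

/-! ### Covariants as invariants of one more form -/

theorem IsWeightedHomogeneous.aeval {α β : Type*} {w : α → ℕ} {w' : β → ℕ}
    {g : α → MvPolynomial β ℂ} (hg : ∀ s, IsWeightedHomogeneous w' (g s) (w s))
    {f : MvPolynomial α ℂ} {j : ℕ} (hf : IsWeightedHomogeneous w f j) :
    IsWeightedHomogeneous w' (MvPolynomial.aeval g f) j := by
  rw [aeval_def, eval₂_eq]
  refine IsWeightedHomogeneous.sum _ _ _ fun m hm => ?_
  rw [algebraMap_eq]
  refine IsWeightedHomogeneous.C_mul ?_ _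
  have h := IsWeightedHomogeneous.prod m.support (fun s => g s ^ m s) (fun s => m s • w s)
    (w := w') fun s _ => (hg s).pow (m s)
  rw [← hf (mem_support_iff.1 hm), Finsupp.weight_apply]
  exact h

/-- The equivariant identification of a vector `x` with the linear form `x 1 * X - x 0 * Y`,
on polynomial functions. -/
noncomputable def covariantEquiv (n : ℕ) :
    MvPolynomial ((Fin n × Fin 2) ⊕ Fin 2) ℂ ≃ₐ[ℂ] MvPolynomial (Option (Fin n) × Fin 2) ℂ :=
  AlgEquiv.ofAlgHom
    (aeval (Sum.elim (fun p => X (some p.1, p.2)) ![-X (none, 1), X (none, 0)]))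
    (aeval fun p => p.1.elim (![X (Sum.inr 1), -X (Sum.inr 0)] p.2) fun i => X (Sum.inl (i, p.2)))
    (by
      refine algHom_ext fun p => ?_
      obtain ⟨_ | i, k⟩ := p
      · fin_cases k <;> simp
      · simp)
    (by
      refine algHom_ext fun s => ?_
      rcases s with ⟨i, k⟩ | k
      · simp
      · fin_cases k <;> simp)

theorem eval_covariantEquiv {n : ℕ} (c : Option (Fin n) → Fin 2 → ℂ)
    (f : MvPolynomial ((Fin n × Fin 2) ⊕ Fin 2) ℂ) :
    eval (fun p => c p.1 p.2) (covariantEquiv n f) =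
      eval (Sum.elim (fun p => c (some p.1) p.2) ![-c none 1, c none 0]) f := by
  rw [← coe_aeval_eq_eval, ← coe_aeval_eq_eval]
  change ((aeval _).comp (covariantEquiv n).toAlgHom) f = (aeval _) f
  congr 1
  refine algHom_ext fun s => ?_
  rcases s with ⟨i, k⟩ | k
  · simp [covariantEquiv]
  · fin_cases k <;> simp [covariantEquiv]

/-- Self-duality of the standard representation: for determinant 1 the inverse is the adjugate, and
a quarter turn intertwines the two actions. -/
theorem formAct_rotate (g : SpecialLinearGroup (Fin 2) ℂ) (c : Fin 2 → ℂ) :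
    ![-formAct g c 1, formAct g c 0] =
      (g : Matrix (Fin 2) (Fin 2) ℂ) *ᵥ ![-c 1, c 0] := by
  change ![-(c ᵥ* adjugate g.1) 1, (c ᵥ* adjugate g.1) 0] = g.1 *ᵥ ![-c 1, c 0]
  rw [adjugate_fin_two]
  funext k
  fin_cases k <;> simp [Matrix.vecMul, Matrix.mulVec, dotProduct, Fin.sum_univ_two] <;> ring

theorem covariantEquiv_mem_iff {n : ℕ} {f : MvPolynomial ((Fin n × Fin 2) ⊕ Fin 2) ℂ} :
    covariantEquiv n f ∈ vectorInvariants (Option (Fin n)) ↔ f ∈ jointCovariants n := by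
  constructor
  · intro h g c x
    have h1 := h g fun o => o.elim ![x 1, -x 0] c
    rw [eval_covariantEquiv fun o => formAct g (o.elim ![x 1, -x 0] c),
      eval_covariantEquiv fun o => o.elim ![x 1, -x 0] c, formAct_rotate] at h1
    have hx : x = ![x 0, x 1] := by funext k; fin_cases k <;> rfl
    rw [hx]
    simpa using h1
  · intro h g c
    rw [eval_covariantEquiv fun o => formAct g (c o), eval_covariantEquiv c, formAct_rotate]
    exact h g (fun i => c (some i)) _

theorem weightedHomogeneous_iff_orderedDegrees {n j : ℕ}
    {f : MvPolynomial (Option (Fin n) × Fin 2) ℂ} :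
    IsWeightedHomogeneous (fun p => p.1.elim 0 fun _ => 1) f j ↔
      f ∈ restrictSupport ℂ (multideg ⁻¹' orderedDegrees (Fin n) j Set.univ) := by
  refine forall_congr' fun m => ?_
  rw [weight_comp_fst fun o : Option (Fin n) => o.elim 0 fun _ => 1, Finset.mem_coe]
  simp only [Fintype.sum_option]
  refine Iff.trans ?_ (imp_congr_left mem_support_iff.symm)
  simp [orderedDegrees]

theorem map_covariantsGrading (n j : ℕ) :
    (covariantsGrading n j).map
      ((covariantEquiv n).toLinearMap ∘ₗ (jointCovariants n).val.toLinearMap) =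
      multidegInvariants (orderedDegrees (Fin n) j Set.univ) := by
  ext f
  simp only [Submodule.mem_map]
  constructor
  · rintro ⟨⟨f, hf⟩, hfj, rfl⟩
    refine ⟨covariantEquiv_mem_iff.2 hf, ?_⟩
    refine weightedHomogeneous_iff_orderedDegrees.1 (IsWeightedHomogeneous.aeval ?_ hfj)
    rintro (p | k)
    · exact isWeightedHomogeneous_X ℂ _ _
    · fin_cases k
      · exact (isWeightedHomogeneous_X ℂ _ _).neg
      · exact isWeightedHomogeneous_X ℂ _ _
  · rintro ⟨hf, hfj⟩
    obtain ⟨f, rfl⟩ := (covariantEquiv n).surjective f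
    refine ⟨⟨f, covariantEquiv_mem_iff.1 hf⟩, ?_, rfl⟩
    have h := weightedHomogeneous_iff_orderedDegrees.2 hfj
    rw [covariantsGrading, Submodule.mem_comap]
    change IsWeightedHomogeneous _ f j
    rw [← (covariantEquiv n).symm_apply_apply f]
    refine IsWeightedHomogeneous.aeval ?_ h
    rintro ⟨_ | i, k⟩
    · fin_cases k
      · exact isWeightedHomogeneous_X ℂ _ _
      · exact (isWeightedHomogeneous_X ℂ _ _).neg
    · exact isWeightedHomogeneous_X ℂ _ _

theorem map_invariantsGrading (n j : ℕ) :
    (invariantsGrading n j).map (jointInvariants n).val.toLinearMap =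
      multidegInvariants {δ : Fin n → ℕ | ∑ i, δ i = j} := by
  have h (f : MvPolynomial (Fin n × Fin 2) ℂ) : f ∈ homogeneousSubmodule (Fin n × Fin 2) ℂ j ↔
      f ∈ restrictSupport ℂ (multideg ⁻¹' {δ : Fin n → ℕ | ∑ i, δ i = j}) := by
    refine forall_congr' fun m => ?_
    rw [Finset.mem_coe]
    refine Iff.trans ?_ (imp_congr_left mem_support_iff.symm)
    have := weight_comp_fst (fun _ => 1) m
    simp only [mul_one] at this
    rw [Set.mem_preimage, Set.mem_ofPred_eq, ← this]
    rfl
  ext f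
  simp only [Submodule.mem_map]
  constructor
  · rintro ⟨⟨f, hf⟩, hfj, rfl⟩
    exact ⟨hf, (h f).1 hfj⟩
  · rintro ⟨hf, hfj⟩
    exact ⟨⟨f, hf⟩, (h f).2 hfj, rfl⟩

theorem finite_and_finrank_eq_of_map_eq {A V : Type*} [AddCommGroup A] [Module ℂ A]
    [AddCommGroup V] [Module ℂ V] {T : A →ₗ[ℂ] V} (hT : Function.Injective T)
    {p : Submodule ℂ A} {q : Submodule ℂ V} (h : p.map T = q) (hq : Module.Finite ℂ q) :
    Module.Finite ℂ p ∧ Module.finrank ℂ p = Module.finrank ℂ q := by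
  subst h
  let e := Submodule.equivMapOfInjective T hT p
  exact ⟨Module.Finite.equiv e.symm, e.finrank_eq⟩

theorem invariantsGrading_finite_and_finrank (n j : ℕ) :
    Module.Finite ℂ (invariantsGrading n j) ∧ Module.finrank ℂ (invariantsGrading n j) =
      Module.finrank ℂ (multidegInvariants {δ : Fin n → ℕ | ∑ i, δ i = j}) :=
  finite_and_finrank_eq_of_map_eq Subtype.val_injective (map_invariantsGrading n j)
    (finite_multidegInvariants_sum j)

theorem covariantsGrading_finite_and_finrank (n j : ℕ) :
    Module.Finite ℂ (covariantsGrading n j) ∧ Module.finrank ℂ (covariantsGrading n j) =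
      n.multichoose (j / 2) * n.multichoose ((j + 1) / 2) := by
  have h := finite_and_finrank_eq_of_map_eq
    (T := (covariantEquiv n).toLinearMap ∘ₗ (jointCovariants n).val.toLinearMap)
    ((covariantEquiv n).injective.comp Subtype.val_injective) (map_covariantsGrading n j)
    (finite_multidegInvariants_univ j)
  rwa [finrank_multidegInvariants_univ, Fintype.card_fin] at h

theorem trdeg_jointInvariants (N : ℕ) :
    Algebra.trdeg ℂ (jointInvariants (N + 2)) = (2 * N + 1 : ℕ) := by
  have h := trdeg_vectorInvariants (σ := Fin (N + 2)) (i₀ := 0) (i₁ := 1) zero_ne_one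
  rw [Fintype.card_fin, Nat.add_sub_cancel] at h
  exact h

theorem trdeg_jointInvariants_one : Algebra.trdeg ℂ (jointInvariants 1) = 0 :=
  trdeg_vectorInvariants_unique (σ := Fin 1)

theorem trdeg_jointCovariants (N : ℕ) :
    Algebra.trdeg ℂ (jointCovariants (N + 1)) = (2 * N + 1 : ℕ) := by
  have h := trdeg_vectorInvariants (σ := Option (Fin (N + 1))) (i₀ := none) (i₁ := some 0)
    (Option.some_ne_none _).symm
  rw [Fintype.card_option, Fintype.card_fin, show N + 1 + 1 - 2 = N by omega] at h
  have hmap : (jointCovariants (N + 1)).map (covariantEquiv (N + 1) : _ →ₐ[ℂ] _) =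
      vectorInvariants (Option (Fin (N + 1))) := by
    ext f
    rw [Subalgebra.mem_map]
    constructor
    · rintro ⟨f, hf, rfl⟩
      exact covariantEquiv_mem_iff.2 hf
    · intro hf
      obtain ⟨f, rfl⟩ := (covariantEquiv (N + 1)).surjective f
      exact ⟨f, covariantEquiv_mem_iff.1 hf, rfl⟩
  rw [← hmap] at h
  rw [← h]
  exact ((covariantEquiv (N + 1)).subalgebraMap (jointCovariants (N + 1))).trdeg_eq

/-! ### Computation of the degrees -/

theorem multichoose_succ_cast (N m : ℕ) :
    ((N + 1).multichoose m : ℝ) = (m + N).factorial / (m.factorial * N.factorial) := by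
  rw [Nat.multichoose_eq, show N + 1 + m - 1 = m + N by omega, Nat.cast_add_choose]

theorem choose_add_cast (N m : ℕ) :
    ((m + N).choose N : ℝ) = (m + N).factorial / (m.factorial * N.factorial) := by
  rw [add_comm m N, Nat.cast_add_choose, mul_comm]

/-- Each product grows like `m^(2N+2)`, but the difference only like `m^(2N)`; the closed form makes
this cancellation exact. -/
theorem narayana_identity (N m : ℕ) :
    ((N + 2).multichoose (m + 1) : ℝ) * (N + 2).multichoose (m + 1) -
      (N + 2).multichoose (m + 2) * (N + 2).multichoose m =
      (m + 1 + N).choose N * (m + 1 + (N + 1)).choose N / (N + 1) := by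
  rw [multichoose_succ_cast, multichoose_succ_cast, multichoose_succ_cast,
    show m + 1 + (N + 1) = m + 2 + N by ring, choose_add_cast, choose_add_cast,
    show m + 2 + (N + 1) = m + N + 1 + 1 + 1 by ring, show m + 2 + N = m + N + 1 + 1 by ring,
    show m + (N + 1) = m + N + 1 by ring, show m + 1 + N = m + N + 1 by ring]
  simp only [Nat.factorial_succ]
  push_cast
  have h1 : ((m + N).factorial : ℝ) ≠ 0 := by positivity
  have h2 : (m.factorial : ℝ) ≠ 0 := by positivity
  have h3 : (N.factorial : ℝ) ≠ 0 := by positivity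
  field_simp
  ring

theorem hasDegree_of_even_odd {R : Type*} [CommRing R] [IsDomain R] [Algebra ℂ R]
    {𝒜 : ℕ → Submodule ℂ R} {k : ℕ} {L₀ L₁ : ℝ} (hfin : ∀ j, Module.Finite ℂ (𝒜 j))
    (htr : Algebra.trdeg ℂ R = (k + 1 : ℕ))
    (h₀ : Tendsto (fun m => (Module.finrank ℂ (𝒜 (2 * m)) : ℝ) / ((m + k).choose k : ℝ))
      atTop (𝓝 L₀))
    (h₁ : Tendsto (fun m => (Module.finrank ℂ (𝒜 (2 * m + 1)) : ℝ) / ((m + k).choose k : ℝ))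
      atTop (𝓝 L₁)) : HasDegree 𝒜 ((L₀ + L₁) / 2 ^ (k + 1)) := by
  refine ⟨hfin, k + 1, by rw [trdeg_fractionRing, htr], ?_, ?_⟩ <;>
    simp only [poincareSeries, PowerSeries.coeff_mk]
  · intro z hz
    exact (even_odd_hasSum (a := fun j => (Module.finrank ℂ (𝒜 j) : ℝ)) h₀ h₁ hz.1 hz.2).summable
  · exact even_odd_tendsto (a := fun j => (Module.finrank ℂ (𝒜 j) : ℝ)) h₀ h₁

theorem hasDegree_covariantsGrading (N : ℕ) :
    HasDegree (covariantsGrading (N + 1)) (N.centralBinom / 4 ^ N) := by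
  have hh (m : ℕ) : ((N + 1).multichoose m : ℝ) = (m + N).choose N := by
    rw [multichoose_succ_cast, choose_add_cast]
  have h := hasDegree_of_even_odd (𝒜 := covariantsGrading (N + 1)) (k := 2 * N)
    (L₀ := N.centralBinom) (L₁ := N.centralBinom)
    (fun j => (covariantsGrading_finite_and_finrank _ j).1) (trdeg_jointCovariants N) ?_ ?_
  · convert! h using 1
    rw [← two_mul, pow_succ, pow_mul]
    norm_num
    field_simp
  · refine (tendsto_choose_mul_choose_div N N N).congr fun m => ?_
    rw [(covariantsGrading_finite_and_finrank _ _).2, show 2 * m / 2 = m by omega,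
      show (2 * m + 1) / 2 = m by omega, Nat.cast_mul, hh]
  · refine (tendsto_choose_mul_choose_div N N (1 + N)).congr fun m => ?_
    rw [(covariantsGrading_finite_and_finrank _ _).2, show (2 * m + 1) / 2 = m by omega,
      show (2 * m + 1 + 1) / 2 = m + 1 by omega, Nat.cast_mul, hh, hh, add_assoc m 1 N]

theorem hasDegree_invariantsGrading (N : ℕ) :
    HasDegree (invariantsGrading (N + 2)) (N.centralBinom / ((N + 1) * 2 ^ (2 * N + 1))) := by
  have h := hasDegree_of_even_odd (𝒜 := invariantsGrading (N + 2)) (k := 2 * N)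
    (L₀ := N.centralBinom / (N + 1)) (L₁ := 0)
    (fun j => (invariantsGrading_finite_and_finrank _ j).1) (trdeg_jointInvariants N) ?_ ?_
  · rwa [add_zero, div_div] at h
  · refine ((tendsto_choose_mul_choose_div N N (N + 1)).div_const (N + 1 : ℝ)).congr' ?_
    filter_upwards [eventually_gt_atTop 0] with m hm
    obtain ⟨m, rfl⟩ : ∃ m', m = m' + 1 := ⟨m - 1, by omega⟩
    have h1 := finrank_multidegInvariants_even (σ := Fin (N + 2)) m
    rw [Fintype.card_fin] at h1
    have h2 := congrArg (Nat.cast (R := ℝ)) h1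
    push_cast at h2
    rw [(invariantsGrading_finite_and_finrank _ _).2, eq_sub_of_add_eq h2, narayana_identity]
    ring
  · refine tendsto_const_nhds.congr fun m => ?_
    rw [(invariantsGrading_finite_and_finrank _ _).2, finrank_multidegInvariants_odd,
      Nat.cast_zero, zero_div]

theorem hasDegree_invariantsGrading_one : HasDegree (invariantsGrading 1) 1 := by
  have hdim (j : ℕ) : Module.finrank ℂ (invariantsGrading 1 j) = if j = 0 then 1 else 0 := by
    rw [(invariantsGrading_finite_and_finrank _ _).2]
    rcases Nat.even_or_odd' j with ⟨m, rfl | rfl⟩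
    · rcases m with _ | m
      · exact finrank_multidegInvariants_zero
      · have h := finrank_multidegInvariants_even (σ := Fin 1) m
        rw [Fintype.card_fin, Nat.multichoose_one, Nat.multichoose_one, Nat.multichoose_one] at h
        rw [if_neg (by omega)]
        omega
    · rw [finrank_multidegInvariants_odd, if_neg (by omega)]
  have hsum (z : ℝ) : HasSum (fun j => (poincareSeries (invariantsGrading 1)).coeff j * z ^ j) 1 := by
    have h : HasSum (fun j => (poincareSeries (invariantsGrading 1)).coeff j * z ^ j) _ :=
      hasSum_single 0 fun j hj => by simp [poincareSeries, hdim, hj]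
    simpa [poincareSeries, hdim] using h
  refine ⟨fun j => (invariantsGrading_finite_and_finrank _ j).1, 0, ?_, fun z _ => (hsum z).summable,
    ?_⟩
  · rw [trdeg_fractionRing, trdeg_jointInvariants_one, Nat.cast_zero]
  · refine tendsto_const_nhds.congr fun z => ?_
    rw [(hsum z).tsum_eq, pow_zero, mul_one]

end LinearForms

theorem mainTheorem4 :
    ∃ degI degC : ℕ → ℝ,
      (∀ n : ℕ, 1 ≤ n → LinearForms.HasDegree (LinearForms.invariantsGrading n) (degI n)) ∧
      (∀ n : ℕ, 1 ≤ n → LinearForms.HasDegree (LinearForms.covariantsGrading n) (degC n)) ∧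
      Asymptotics.IsEquivalent Filter.atTop degI
        (fun n : ℕ => 1 / (2 * Real.sqrt (Real.pi * (n : ℝ) ^ 3))) ∧
      Asymptotics.IsEquivalent Filter.atTop degC
        (fun n : ℕ => 1 / Real.sqrt (Real.pi * (n : ℝ))) := by
  -- For one form the invariants are the constants, with Poincaré series 1 and `r = 0`; the general
  -- formula would divide by `n - 1 = 0`.
  refine ⟨fun n => if n = 1 then 1 else
      ((n - 2).centralBinom : ℝ) / (((n - 1 : ℕ) : ℝ) * 2 ^ (2 * (n - 2) + 1)),
    fun n => ((n - 1).centralBinom : ℝ) / 4 ^ (n - 1), fun n hn => ?_, fun n hn => ?_, ?_,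
    LinearForms.centralBinom_pred_isEquivalent⟩
  · dsimp only
    split_ifs with h
    · subst h
      exact LinearForms.hasDegree_invariantsGrading_one
    · obtain ⟨N, rfl⟩ : ∃ N, n = N + 2 := ⟨n - 2, by omega⟩
      have h := LinearForms.hasDegree_invariantsGrading N
      rw [Nat.add_sub_cancel, show N + 2 - 1 = N + 1 by omega]
      push_cast
      exact h
  · obtain ⟨N, rfl⟩ : ∃ N, n = N + 1 := ⟨n - 1, by omega⟩
    exact LinearForms.hasDegree_covariantsGrading N
  · refine LinearForms.centralBinom_catalan_isEquivalent.congr_left ?_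
    filter_upwards [Filter.eventually_gt_atTop 1] with n hn
    rw [if_neg (by omega)]
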